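/- Let $m\ge 1$, $N=2^m$, and index the coordinates of $\mathbb{C}^N=(\mathbb{C}^2)^{\otimes m}$ by $\mathbb{F}_2^m$ (row vectors). For $a,b\in\mathbb{F}_2^m$ put $D(a,b)=X^{a_1}Z^{b_1}\otimes\cdots\otimes X^{a_m}Z^{b_m}$ and $E(a,b)=\imath^{ab^T}D(a,b)$, where $X,Z$ are the Pauli matrices. Let $HW_N=\{\imath^{\kappa}D(a,b)\}$, and let $\mathrm{Cliff}_N$ be the group of unitary $g$ with $gD(a,b)g^{\dagger}\in HW_N$ for all $a,b$. For $g\in\mathrm{Cliff}_N$ let $\phi(g)=F\in\mathrm{Sp}(2m,\mathbb{F}_2)$ be the matrix with $gE(a,b)g^{\dagger}=\pm E([a,b]F)$ for all $a,b$. Let $\alpha$ be a primitive element of $\mathbb{F}_{2^m}$ and identify $\mathbb{F}_{2^m}$ with $\mathbb{F}_2^m$ by the basis $1,\alpha,\dots,\alpha^{m-1}$. Let $A_z$ be the matrix of $x\mapsto xz$ and $R$ the matrix of $x\mapsto x^2$ (acting on row vectors), and let $W_{ij}=\mathrm{Tr}(\alpha^{i}\alpha^{j})$, $0\le i,j<m$.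 Put $$\Omega=\begin{bmatrix}0&I\\I&0\end{bmatrix},\qquad L_Q=\begin{bmatrix}Q&0\\0&Q^{-T}\end{bmatrix},\qquad T_P=\begin{bmatrix}I&P\\0&I\end{bmatrix},$$ $$\mathfrak{P}_{K,m}=\langle T_{A_x^2W},\ L_{A_y^{-1}},\ \Omega L_{W^{-1}}\rangle,\qquad \mathfrak{P}^*_{K,m}=\langle T_{A_x^2W},\ L_{R^{-i}A_y^{-1}},\ \Omega L_{W^{-1}}\rangle,$$ where $x\in\mathbb{F}_{2^m}$, $y\in\mathbb{F}_{2^m}\setminus\{0\}$ and $0\le i<m$. A finite ensemble $\{p_j,U_j\}$ of $N\times N$ unitary matrices with probabilities $p_j$ is a unitary $k$-design if for every linear operator $X$ on $(\mathbb{C}^N)^{\otimes k}$ $$\sum_j p_j\,U_j^{\otimes k}X(U_j^{\dagger})^{\otimes k}=\int_{\mathbb{U}_N}U^{\otimes k}X(U^{\dagger})^{\otimes k}\,d\eta(U),$$ where $\eta$ is the Haar probability measure on the unitary group $\mathbb{U}_N$. Global phases do not affect this. A finite ensemble samples uniformly from a set $S\subseteq\mathbb{U}_N$ that is finite up to global phases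 if it selects only elements of $S$ and the class of the selected matrix modulo global phases is uniformly distributed over the classes of elements of $S$. Then: 1. $\mathrm{Cliff}_N$ is finite up to global phases, and every finite ensemble that samples uniformly from it is a unitary $3$-design. 2. Let $G$ be $\mathfrak{P}_{K,m}$ or $\mathfrak{P}^*_{K,m}$. Then $\phi^{-1}(G)$ is finite up to global phases, every $F\in G$ equals $\phi(g)$ for some $g\in\mathrm{Cliff}_N$, and: (a) every finite ensemble that samples uniformly from $\phi^{-1}(G)$ is a unitary $2$-design, both by itself and when followed by an independent uniformly random Pauli matrix $D(a,b)$; (b) if $F\in G$ is sampled uniformly and lifted in any way (by a finite ensemble) to $g\in\mathrm{Cliff}_N$ with $\phi(g)=F$, then $g$ followed by an independent uniformly random Pauli matrix, i.e. the ensemble of the matrices $D(a,b)\,g$, is a unitary $2$-design (the Kerdock design, or the enlarged Kerdock design for $\mathfrak{P}^*_{K,m}$). -/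

import Mathlib

open scoped Matrix

noncomputable section

namespace KerdockDesign

/-! ## Kronecker products, unitary ensembles and unitary designs -/

/-- The Kronecker (tensor) product of a finite family of square matrices, with rows and columns
indexed by tuples. -/
def kron {κ n : Type*} [Fintype κ] (A : κ → Matrix n n ℂ) : Matrix (κ → n) (κ → n) ℂ :=
  Matrix.of fun u v => ∏ t, A t (u t) (v t)

theorem kron_mul {κ n : Type*} [Fintype κ] [DecidableEq κ] [Fintype n]
    (A B : κ → Matrix n n ℂ) : kron A * kron B = kron fun t => A t * B t := by
  ext u v
  simp only [kron, Matrix.mul_apply, Matrix.of_apply, Finset.prod_univ_sum,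
    Fintype.piFinset_univ, Finset.prod_mul_distrib]

theorem kron_conjTranspose {κ n : Type*} [Fintype κ] (A : κ → Matrix n n ℂ) :
    (kron A)ᴴ = kron fun t => (A t)ᴴ := by
  ext u v
  simp [kron, Matrix.conjTranspose_apply]

theorem kron_one {κ n : Type*} [Fintype κ] [DecidableEq n] :
    kron (fun _ : κ => (1 : Matrix n n ℂ)) = 1 := by
  ext u v
  by_cases h : u = v
  · subst h; simp [kron]
  · obtain ⟨t, ht⟩ := Function.ne_iff.mp h
    rw [Matrix.one_apply_ne h]
    exact Finset.prod_eq_zero (Finset.mem_univ t) (Matrix.one_apply_ne ht)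

theorem kron_mem_unitaryGroup {κ n : Type*} [Fintype κ] [DecidableEq κ] [Fintype n]
    [DecidableEq n] (A : κ → Matrix n n ℂ) (hA : ∀ t, A t ∈ Matrix.unitaryGroup n ℂ) :
    kron A ∈ Matrix.unitaryGroup (κ → n) ℂ := by
  rw [Matrix.mem_unitaryGroup_iff, Matrix.star_eq_conjTranspose, kron_conjTranspose, kron_mul]
  have h : (fun t => A t * (A t)ᴴ) = fun _ => 1 :=
    funext fun t => Matrix.mem_unitaryGroup_iff.mp (hA t)
  rw [h, kron_one]

/-- The `k`-th tensor power `U^{⊗k}` of a matrix. -/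
def tensorPower {n : Type*} (k : ℕ) (U : Matrix n n ℂ) : Matrix (Fin k → n) (Fin k → n) ℂ :=
  kron fun _ : Fin k => U

instance unitaryGroup_compactSpace (n : Type*) [Fintype n] [DecidableEq n] :
    CompactSpace (Matrix.unitaryGroup n ℂ) := by
  apply isCompact_iff_compactSpace.mp
  have hsub : ((Matrix.unitaryGroup n ℂ : Submonoid (Matrix n n ℂ)) : Set (Matrix n n ℂ)) ⊆
      Set.pi Set.univ fun _ : n => Set.pi Set.univ fun _ : n => Metric.closedBall (0 : ℂ) 1 := by
    intro U hU i _ j _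
    rw [mem_closedBall_zero_iff]
    exact entry_norm_bound_of_unitary hU i j
  refine IsCompact.of_isClosed_subset (isCompact_univ_pi fun _ => isCompact_univ_pi fun _ =>
    isCompact_closedBall (0 : ℂ) 1) ?_ hsub
  have h : ((Matrix.unitaryGroup n ℂ : Submonoid (Matrix n n ℂ)) : Set (Matrix n n ℂ)) =
      (fun U : Matrix n n ℂ => U * star U) ⁻¹' {1} := by
    ext U
    exact Matrix.mem_unitaryGroup_iff
  rw [h]
  exact isClosed_singleton.preimage (by fun_prop)

/-- The unitary group carries its Borel σ-algebra. -/
instance unitaryGroup_measurableSpace (n : Type*) [Fintype n] [DecidableEq n] :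
    MeasurableSpace (Matrix.unitaryGroup n ℂ) := borel _

instance unitaryGroup_borelSpace (n : Type*) [Fintype n] [DecidableEq n] :
    BorelSpace (Matrix.unitaryGroup n ℂ) := ⟨rfl⟩

/-- The Haar measure on the unitary group, normalized to be a probability measure. -/
def unitaryHaar (n : Type*) [Fintype n] [DecidableEq n] :
    MeasureTheory.Measure (Matrix.unitaryGroup n ℂ) :=
  MeasureTheory.Measure.haarMeasure ⊤

/-- The `k`-fold action `X ↦ U^{⊗k} X (U†)^{⊗k}` of a matrix `U`. -/
def tensorConj {n : Type*} [Fintype n] (k : ℕ) (U : Matrix n n ℂ)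
    (X : Matrix (Fin k → n) (Fin k → n) ℂ) : Matrix (Fin k → n) (Fin k → n) ℂ :=
  tensorPower k U * X * tensorPower k Uᴴ

/-- The full `k`-fold unitary twirl `∫ U^{⊗k} X (U†)^{⊗k} dη(U)`; the integral of a
matrix-valued function is taken entry by entry. -/
def haarTwirl {n : Type*} [Fintype n] [DecidableEq n] (k : ℕ)
    (X : Matrix (Fin k → n) (Fin k → n) ℂ) : Matrix (Fin k → n) (Fin k → n) ℂ :=
  Matrix.of fun I J => ∫ U : Matrix.unitaryGroup n ℂ,
    tensorConj k (U : Matrix n n ℂ) X I J ∂(unitaryHaar n)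

/-- A finite ensemble `{p_i, U_i}`: the unitary matrix `U_i` is selected with
probability `p_i`. -/
structure UnitaryEnsemble (ι n : Type*) [Fintype ι] [Fintype n] [DecidableEq n] where
  prob : ι → ℝ
  prob_nonneg : ∀ i, 0 ≤ prob i
  prob_sum : ∑ i, prob i = 1
  unitary : ι → Matrix.unitaryGroup n ℂ

/-- The `k`-fold twirl `∑_i p_i U_i^{⊗k} X (U_i†)^{⊗k}` of an ensemble. -/
def UnitaryEnsemble.twirl {ι n : Type*} [Fintype ι] [Fintype n] [DecidableEq n]
    (E : UnitaryEnsemble ι n) (k : ℕ) (X : Matrix (Fin k → n) (Fin k → n) ℂ) :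
    Matrix (Fin k → n) (Fin k → n) ℂ :=
  ∑ i, (E.prob i : ℂ) • tensorConj k (E.unitary i : Matrix n n ℂ) X

/-- An ensemble is a unitary `k`-design if its `k`-fold twirl coincides with the full
`k`-fold unitary twirl. -/
def UnitaryEnsemble.IsUnitaryDesign {ι n : Type*} [Fintype ι] [Fintype n] [DecidableEq n]
    (E : UnitaryEnsemble ι n) (k : ℕ) : Prop :=
  ∀ X : Matrix (Fin k → n) (Fin k → n) ℂ, E.twirl k X = haarTwirl k X

/-- Equality of unitary matrices up to a scalar (global phase). -/
def phaseSetoid (n : Type*) [Fintype n] [DecidableEq n] : Setoid (Matrix.unitaryGroup n ℂ) where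
  r U V := ∃ c : ℂ, ‖c‖ = 1 ∧ (U : Matrix n n ℂ) = c • (V : Matrix n n ℂ)
  iseqv :=
    { refl := fun _ => ⟨1, by simp, by simp⟩
      symm := by
        rintro U V ⟨c, hc, h⟩
        have h0 : c ≠ 0 := norm_ne_zero_iff.mp (by simp [hc])
        exact ⟨c⁻¹, by simp [hc], by rw [h, smul_smul, inv_mul_cancel₀ h0, one_smul]⟩
      trans := by
        rintro U V W ⟨c, hc, h⟩ ⟨d, hd, h'⟩
        exact ⟨c * d, by simp [hc, hd], by rw [h, h', smul_smul]⟩ }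

/-- The set of classes, up to a global phase, of the elements of a set of unitary matrices. -/
def phaseClasses {n : Type*} [Fintype n] [DecidableEq n] (S : Set (Matrix.unitaryGroup n ℂ)) :
    Set (Quotient (phaseSetoid n)) :=
  Quotient.mk (phaseSetoid n) '' S

open Classical in
/-- The ensemble samples uniformly from `S`, global phases being ignored: it only selects
elements of `S`, and the class of the selected matrix is uniformly distributed over the finite
set of classes of elements of `S` up to a global phase. -/
def UnitaryEnsemble.IsUniformOn {ι n : Type*} [Fintype ι] [Fintype n] [DecidableEq n]
    (E : UnitaryEnsemble ι n) (S : Set (Matrix.unitaryGroup n ℂ)) : Prop :=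
  (phaseClasses S).Finite ∧
  (∀ i, E.prob i ≠ 0 → E.unitary i ∈ S) ∧
  ∀ c ∈ phaseClasses S,
    (∑ i, if Quotient.mk (phaseSetoid n) (E.unitary i) = c then E.prob i else 0) =
      1 / ((phaseClasses S).ncard : ℝ)

/-! ## The Heisenberg-Weyl group and the Clifford group -/

/-- The Pauli matrix `X`. -/
def pauliX : Matrix (ZMod 2) (ZMod 2) ℂ := Matrix.of fun i j => if i = j + 1 then 1 else 0

/-- The Pauli matrix `Z`. -/
def pauliZ : Matrix (ZMod 2) (ZMod 2) ℂ := Matrix.diagonal fun i => if i = 0 then 1 else -1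

/-- Binary vectors of length `m`; they also index the coordinates of `ℂ^N`, `N = 2 ^ m`. -/
abbrev BinVec (m : ℕ) : Type := Fin m → ZMod 2

/-- The group of `N × N` unitary matrices, `N = 2 ^ m`. -/
abbrev UnitaryN (m : ℕ) : Type := Matrix.unitaryGroup (BinVec m) ℂ

/-- `D(a,b) = X^{a_1} Z^{b_1} ⊗ ⋯ ⊗ X^{a_m} Z^{b_m}`. -/
def pauliD {m : ℕ} (a b : BinVec m) : Matrix (BinVec m) (BinVec m) ℂ :=
  kron fun i => pauliX ^ (a i).val * pauliZ ^ (b i).val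

theorem pauliX_mem : pauliX ∈ Matrix.unitaryGroup (ZMod 2) ℂ := by
  rw [Matrix.mem_unitaryGroup_iff]
  ext i j
  have h : ∀ i j : ZMod 2, (j = i + 1) = (i = j + 1) := by decide
  have h' : ∀ i k : ZMod 2, (i + 1 = k + 1) = (i = k) := by decide
  simp [pauliX, Matrix.mul_apply, Matrix.star_apply, Matrix.one_apply, h, h', eq_comm]

theorem pauliZ_mem : pauliZ ∈ Matrix.unitaryGroup (ZMod 2) ℂ := by
  rw [Matrix.mem_unitaryGroup_iff]
  rw [pauliZ, Matrix.star_eq_conjTranspose, Matrix.diagonal_conjTranspose,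
    Matrix.diagonal_mul_diagonal, ← Matrix.diagonal_one]
  congr 1
  ext i
  by_cases hi : i = 0 <;> simp [hi]

theorem pauliD_mem {m : ℕ} (a b : BinVec m) :
    pauliD a b ∈ Matrix.unitaryGroup (BinVec m) ℂ :=
  kron_mem_unitaryGroup _ fun _ => mul_mem (pow_mem pauliX_mem _) (pow_mem pauliZ_mem _)

/-- `D(a,b)` as an element of the unitary group. -/
def pauliDU {m : ℕ} (a b : BinVec m) : UnitaryN m := ⟨pauliD a b, pauliD_mem a b⟩

/-- The Hermitian Pauli matrix `E(a,b) = i^{a bᵀ} D(a,b)`. -/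
def pauliE {m : ℕ} (a b : BinVec m) : Matrix (BinVec m) (BinVec m) ℂ :=
  Complex.I ^ (a ⬝ᵥ b).val • pauliD a b

/-- The Heisenberg-Weyl group: all matrices `i^κ D(a,b)`, `κ ∈ {0,1,2,3}`. -/
def heisenbergWeyl (m : ℕ) : Set (Matrix (BinVec m) (BinVec m) ℂ) :=
  {M | ∃ (κ : Fin 4) (a b : BinVec m), M = Complex.I ^ (κ : ℕ) • pauliD a b}

/-- The Clifford group: all unitary `g` with `g D(a,b) g† ∈ HW_N` for all `a, b`. -/
def cliffordGroup (m : ℕ) : Set (UnitaryN m) :=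
  {g | ∀ a b : BinVec m,
    (g : Matrix (BinVec m) (BinVec m) ℂ) * pauliD a b * (g : Matrix _ _ ℂ)ᴴ ∈ heisenbergWeyl m}

/-- `2m × 2m` binary matrices, in blocks of size `m`. -/
abbrev BlockMatrix (m : ℕ) : Type := Matrix (Fin m ⊕ Fin m) (Fin m ⊕ Fin m) (ZMod 2)

/-- The binary symplectic group `Sp(2m, 𝔽₂)`. -/
abbrev SpBinary (m : ℕ) : Type := Matrix.symplecticGroup (Fin m) (ZMod 2)

/-- The relation `φ(g) = F`, i.e. `g E(a,b) g† = ± E([a,b] F)` for all `a, b`. -/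
def InducesSymplectic {m : ℕ} (g : UnitaryN m) (F : BlockMatrix m) : Prop :=
  ∀ a b : BinVec m,
    let v := Sum.elim a b ᵥ* F
    let M := (g : Matrix (BinVec m) (BinVec m) ℂ) * pauliE a b * (g : Matrix _ _ ℂ)ᴴ
    M = pauliE (v ∘ Sum.inl) (v ∘ Sum.inr) ∨ M = -pauliE (v ∘ Sum.inl) (v ∘ Sum.inr)

/-- The preimage `φ⁻¹(G)` in the Clifford group of a group `G` of symplectic matrices. -/
def cliffordPreimage {m : ℕ} (G : Subgroup (SpBinary m)) : Set (UnitaryN m) :=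
  {g | g ∈ cliffordGroup m ∧ ∃ F ∈ G, InducesSymplectic g (F : BlockMatrix m)}

open Classical in
/-- The ensemble consists of Clifford matrices `g` whose symplectic matrices `φ(g)` are uniformly
distributed over the group `G`: it samples `F ∈ G` uniformly at random and then chooses, in
whatever way, a Clifford matrix `g` with `φ(g) = F`. -/
def UnitaryEnsemble.LiftsUniform {ι : Type*} [Fintype ι] {m : ℕ}
    (E : UnitaryEnsemble ι (BinVec m)) (G : Subgroup (SpBinary m)) : Prop :=
  (∀ i, E.prob i ≠ 0 → E.unitary i ∈ cliffordPreimage G) ∧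
  ∀ F ∈ G,
    (∑ i, if InducesSymplectic (E.unitary i) (F : BlockMatrix m) then E.prob i else 0) =
      1 / (Nat.card G : ℝ)

/-- Sampling from the ensemble, followed by an independent, uniformly random Pauli matrix
`D(a,b)`: the matrix `D(a,b) U_i` is selected with probability `p_i / N²`. -/
def UnitaryEnsemble.thenPauli {ι : Type*} [Fintype ι] {m : ℕ}
    (E : UnitaryEnsemble ι (BinVec m)) :
    UnitaryEnsemble (ι × BinVec m × BinVec m) (BinVec m) where
  prob x := E.prob x.1 / ((2 : ℝ) ^ m) ^ 2
  prob_nonneg x := div_nonneg (E.prob_nonneg _) (by positivity)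
  prob_sum := by
    rw [Fintype.sum_prod_type]
    simp only [Finset.sum_const, nsmul_eq_mul, Finset.card_univ, Fintype.card_prod,
      Fintype.card_pi, ZMod.card, Finset.prod_const, Fintype.card_fin]
    rw [← Finset.mul_sum, ← Finset.sum_div, E.prob_sum]
    push_cast
    field_simp
  unitary x := pauliDU x.2.1 x.2.2 * E.unitary x.1

/-! ## The symplectic groups of the Kerdock mutually unbiased bases -/

/-- The polynomial basis `1, α, …, α^{m-1}` of the field with `2 ^ m` elements, for a primitive
element `α`. -/
def polyBasis {m : ℕ} {K : Type*} [Field K] [Algebra (ZMod 2) K] (hm : 0 < m)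
    (hK : Module.finrank (ZMod 2) K = m) (α : K) (hα : IsPrimitiveRoot α (2 ^ m - 1)) :
    Module.Basis (Fin m) (ZMod 2) K :=
  have hli : LinearIndependent (ZMod 2) fun i : Fin m => α ^ (i : ℕ) := by
    have : FiniteDimensional (ZMod 2) K := Module.finite_of_finrank_pos (by omega)
    have : Finite K := Module.finite_of_finite (ZMod 2)
    have hcard : Nat.card K = 2 ^ m := by
      rw [Module.natCard_eq_pow_finrank (K := ZMod 2), hK, Nat.card_zmod]
    have h2 : 2 ≤ 2 ^ m := by simpa using Nat.pow_le_pow_right (n := 2) (by norm_num) hm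
    have : NeZero (2 ^ m - 1) := ⟨by omega⟩
    have htop : IntermediateField.adjoin (ZMod 2) {α} = ⊤ := by
      rw [eq_top_iff]
      intro x _
      rcases eq_or_ne x 0 with rfl | hx
      · exact zero_mem _
      · have := Fintype.ofFinite K
        have hx1 : x ^ (2 ^ m - 1) = 1 := by
          rw [← hcard, Nat.card_eq_fintype_card]
          exact FiniteField.pow_card_sub_one_eq_one x hx
        obtain ⟨i, _, rfl⟩ := hα.eq_pow_of_pow_eq_one hx1
        exact pow_mem (IntermediateField.mem_adjoin_simple_self _ α) i
    have hdeg : (minpoly (ZMod 2) α).natDegree = m := by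
      rw [(Field.primitive_element_iff_minpoly_natDegree_eq (ZMod 2) α).mp htop, hK]
    exact (linearIndependent_pow α).comp (Fin.cast hdeg.symm) (Fin.cast_injective _)
  haveI : Nonempty (Fin m) := ⟨⟨0, hm⟩⟩
  basisOfLinearIndependentOfCardEqFinrank hli (by simp [hK])

theorem polyBasis_apply {m : ℕ} {K : Type*} [Field K] [Algebra (ZMod 2) K] (hm : 0 < m)
    (hK : Module.finrank (ZMod 2) K = m) (α : K) (hα : IsPrimitiveRoot α (2 ^ m - 1))
    (i : Fin m) : polyBasis hm hK α hα i = α ^ (i : ℕ) := by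
  simp [polyBasis]

/-- The matrix `A_z` of multiplication by `z`, acting on row vectors of coordinates. -/
def mulMat {m : ℕ} {K : Type*} [Field K] [Algebra (ZMod 2) K]
    (b : Module.Basis (Fin m) (ZMod 2) K) (z : K) : Matrix (Fin m) (Fin m) (ZMod 2) :=
  Matrix.of fun i j => b.repr (b i * z) j

/-- The matrix `R` of the Frobenius map `x ↦ x²`, acting on row vectors of coordinates. -/
def frobMat {m : ℕ} {K : Type*} [Field K] [Algebra (ZMod 2) K]
    (b : Module.Basis (Fin m) (ZMod 2) K) : Matrix (Fin m) (Fin m) (ZMod 2) :=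
  Matrix.of fun i j => b.repr (b i ^ 2) j

/-- The Gram matrix `W` of the trace form, `Tr(xy) = x W yᵀ`. -/
def traceMat {m : ℕ} {K : Type*} [Field K] [Algebra (ZMod 2) K]
    (b : Module.Basis (Fin m) (ZMod 2) K) : Matrix (Fin m) (Fin m) (ZMod 2) :=
  Matrix.of fun i j => Algebra.trace (ZMod 2) K (b i * b j)

/-- `Ω = [0, I; I, 0]`. -/
def sympOmega (m : ℕ) : BlockMatrix m := Matrix.fromBlocks 0 1 1 0

/-- `L_Q = [Q, 0; 0, Q^{-T}]`, for invertible `Q`. -/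
def sympL {m : ℕ} (Q : Matrix (Fin m) (Fin m) (ZMod 2)) : BlockMatrix m :=
  Matrix.fromBlocks Q 0 0 Q⁻¹ᵀ

/-- `T_P = [I, P; 0, I]`, for symmetric `P`. -/
def sympT {m : ℕ} (P : Matrix (Fin m) (Fin m) (ZMod 2)) : BlockMatrix m :=
  Matrix.fromBlocks 1 P 0 1

/-- The generators `T_{A_x² W}`, `L_{A_x⁻¹}` (`x ≠ 0`) and `Ω L_{W⁻¹}`. -/
def kerdockGens {m : ℕ} {K : Type*} [Field K] [Algebra (ZMod 2) K]
    (b : Module.Basis (Fin m) (ZMod 2) K) : Set (BlockMatrix m) :=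
  {F | (∃ x : K, F = sympT (mulMat b x ^ 2 * traceMat b)) ∨
    (∃ x : K, x ≠ 0 ∧ F = sympL (mulMat b x)⁻¹) ∨
    F = sympOmega m * sympL (traceMat b)⁻¹}

/-- The generators `T_{A_x² W}`, `L_{R⁻ⁱ A_x⁻¹}` (`x ≠ 0`, `0 ≤ i < m`) and `Ω L_{W⁻¹}`. -/
def kerdockStarGens {m : ℕ} {K : Type*} [Field K] [Algebra (ZMod 2) K]
    (b : Module.Basis (Fin m) (ZMod 2) K) : Set (BlockMatrix m) :=
  {F | (∃ x : K, F = sympT (mulMat b x ^ 2 * traceMat b)) ∨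
    (∃ (x : K) (i : Fin m), x ≠ 0 ∧
      F = sympL ((frobMat b)⁻¹ ^ (i : ℕ) * (mulMat b x)⁻¹)) ∨
    F = sympOmega m * sympL (traceMat b)⁻¹}

/-- The group `𝔓_{K,m}` of symplectic matrices generated by `kerdockGens`. -/
def kerdockGroup {m : ℕ} {K : Type*} [Field K] [Algebra (ZMod 2) K]
    (b : Module.Basis (Fin m) (ZMod 2) K) : Subgroup (SpBinary m) :=
  Subgroup.closure {F | (F : BlockMatrix m) ∈ kerdockGens b}

/-- The enlarged group `𝔓*_{K,m}` of symplectic matrices generated by `kerdockStarGens`. -/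
def kerdockStarGroup {m : ℕ} {K : Type*} [Field K] [Algebra (ZMod 2) K]
    (b : Module.Basis (Fin m) (ZMod 2) K) : Subgroup (SpBinary m) :=
  Subgroup.closure {F | (F : BlockMatrix m) ∈ kerdockStarGens b}

/-! Every generator is indeed a symplectic matrix, so that none is lost in the two closures. -/

theorem sympOmega_mem (m : ℕ) : sympOmega m ∈ Matrix.symplecticGroup (Fin m) (ZMod 2) := by
  have h : sympOmega m = Matrix.J (Fin m) (ZMod 2) := by
    rw [sympOmega, Matrix.J]
    congr 1
    ext i j
    simp [ZMod.neg_eq_self_mod_two]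
  rw [h]
  exact SymplecticGroup.J_mem _ _

theorem sympL_mem {m : ℕ} (Q : Matrix (Fin m) (Fin m) (ZMod 2)) (hQ : IsUnit Q.det) :
    sympL Q ∈ Matrix.symplecticGroup (Fin m) (ZMod 2) := by
  rw [SymplecticGroup.mem_iff, sympL, Matrix.J, Matrix.fromBlocks_transpose,
    Matrix.fromBlocks_multiply, Matrix.fromBlocks_multiply]
  simp [← Matrix.transpose_mul, Matrix.mul_nonsing_inv _ hQ]

theorem sympT_mem {m : ℕ} (P : Matrix (Fin m) (Fin m) (ZMod 2)) (hP : P.IsSymm) :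
    sympT P ∈ Matrix.symplecticGroup (Fin m) (ZMod 2) := by
  rw [SymplecticGroup.mem_iff, sympT, Matrix.J, Matrix.fromBlocks_transpose,
    Matrix.fromBlocks_multiply, Matrix.fromBlocks_multiply]
  simp [hP.eq]

theorem traceMat_eq_toMatrix {m : ℕ} {K : Type*} [Field K] [Algebra (ZMod 2) K]
    (b : Module.Basis (Fin m) (ZMod 2) K) :
    traceMat b = LinearMap.BilinForm.toMatrix b (Algebra.traceForm (ZMod 2) K) := by
  ext i j
  simp [traceMat, Algebra.traceForm_apply]

theorem isUnit_det_traceMat {m : ℕ} {K : Type*} [Field K] [Algebra (ZMod 2) K]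
    (b : Module.Basis (Fin m) (ZMod 2) K) : IsUnit (traceMat b).det := by
  have : FiniteDimensional (ZMod 2) K := Module.Basis.finiteDimensional_of_finite b
  have : Finite K := Module.finite_of_finite (ZMod 2)
  rw [isUnit_iff_ne_zero, traceMat_eq_toMatrix]
  exact (LinearMap.BilinForm.nondegenerate_iff_det_ne_zero b).mp
    (traceForm_nondegenerate (ZMod 2) K)

theorem mulMat_mul {m : ℕ} {K : Type*} [Field K] [Algebra (ZMod 2) K]
    (b : Module.Basis (Fin m) (ZMod 2) K) (x y : K) :
    mulMat b x * mulMat b y = mulMat b (x * y) := by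
  have key : ∀ z, mulMat b z = (Algebra.leftMulMatrix b z)ᵀ := by
    intro z
    ext i j
    simp [mulMat, Algebra.leftMulMatrix_eq_repr_mul, mul_comm]
  rw [key, key, key, ← Matrix.transpose_mul, ← map_mul, mul_comm]

theorem isUnit_det_mulMat {m : ℕ} {K : Type*} [Field K] [Algebra (ZMod 2) K]
    (b : Module.Basis (Fin m) (ZMod 2) K) {x : K} (hx : x ≠ 0) : IsUnit (mulMat b x).det := by
  have h1 : mulMat b (1 : K) = 1 := by
    ext i j
    simp [mulMat, Matrix.one_apply, Finsupp.single_apply]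
  have h : mulMat b x * mulMat b x⁻¹ = 1 := by rw [mulMat_mul, mul_inv_cancel₀ hx, h1]
  exact Matrix.isUnit_det_of_right_inverse h

theorem isUnit_det_frobMat {m : ℕ} {K : Type*} [Field K] [Algebra (ZMod 2) K]
    (b : Module.Basis (Fin m) (ZMod 2) K) : IsUnit (frobMat b).det := by
  have : FiniteDimensional (ZMod 2) K := Module.Basis.finiteDimensional_of_finite b
  have : Finite K := Module.finite_of_finite (ZMod 2)
  have : CharP K 2 := charP_of_injective_algebraMap (algebraMap (ZMod 2) K).injective 2
  have : ExpChar K 2 := ExpChar.prime Nat.prime_two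
  let f : K ≃ₗ[ZMod 2] K := (FiniteField.frobeniusAlgEquiv (ZMod 2) K 2).toLinearEquiv
  have h : frobMat b = (LinearMap.toMatrix b b (f : K →ₗ[ZMod 2] K))ᵀ := by
    ext i j
    simp [frobMat, LinearMap.toMatrix_apply, f]
  rw [h, Matrix.det_transpose]
  exact LinearEquiv.isUnit_det f b b

theorem mulMat_mul_traceMat_isSymm {m : ℕ} {K : Type*} [Field K] [Algebra (ZMod 2) K]
    (b : Module.Basis (Fin m) (ZMod 2) K) (z : K) : (mulMat b z * traceMat b).IsSymm := by
  have h : ∀ i j, (mulMat b z * traceMat b) i j = Algebra.trace (ZMod 2) K (b i * z * b j) := by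
    intro i j
    conv_rhs => rw [← b.sum_repr (b i * z), Finset.sum_mul, map_sum]
    simp [Matrix.mul_apply, mulMat, traceMat]
  ext i j
  rw [Matrix.transpose_apply, h, h]
  congr 1
  ring

theorem kerdockGens_subset {m : ℕ} {K : Type*} [Field K] [Algebra (ZMod 2) K]
    (b : Module.Basis (Fin m) (ZMod 2) K) :
    kerdockGens b ⊆ Matrix.symplecticGroup (Fin m) (ZMod 2) := by
  rintro F (⟨x, rfl⟩ | ⟨x, hx, rfl⟩ | rfl)
  · rw [pow_two, mulMat_mul]
    exact sympT_mem _ (mulMat_mul_traceMat_isSymm b _)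
  · exact sympL_mem _ (Matrix.isUnit_nonsing_inv_det _ (isUnit_det_mulMat b hx))
  · exact mul_mem (sympOmega_mem m)
      (sympL_mem _ (Matrix.isUnit_nonsing_inv_det _ (isUnit_det_traceMat b)))

theorem kerdockStarGens_subset {m : ℕ} {K : Type*} [Field K] [Algebra (ZMod 2) K]
    (b : Module.Basis (Fin m) (ZMod 2) K) :
    kerdockStarGens b ⊆ Matrix.symplecticGroup (Fin m) (ZMod 2) := by
  rintro F (⟨x, rfl⟩ | ⟨x, i, hx, rfl⟩ | rfl)
  · rw [pow_two, mulMat_mul]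
    exact sympT_mem _ (mulMat_mul_traceMat_isSymm b _)
  · refine sympL_mem _ ?_
    rw [Matrix.det_mul, Matrix.det_pow]
    exact ((Matrix.isUnit_nonsing_inv_det _ (isUnit_det_frobMat b)).pow _).mul
      (Matrix.isUnit_nonsing_inv_det _ (isUnit_det_mulMat b hx))
  · exact mul_mem (sympOmega_mem m)
      (sympL_mem _ (Matrix.isUnit_nonsing_inv_det _ (isUnit_det_traceMat b)))

end KerdockDesign

end

open KerdockDesign

noncomputable section

namespace KerdockDesign

open MeasureTheory

/-! ## Tensor powers and twirls -/

section Twirl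

variable {n : Type*} [Fintype n] [DecidableEq n]

/-! Let `L` be the difference of the ensemble twirl and the Haar twirl (`UnitaryEnsemble.defect`);
the goal is `L = 0`. Two properties suffice. First, `L` kills every operator fixed by all `U^{⊗k}`,
in particular the identity and the permutations of tensor factors. Second, under uniform sampling
from a multiplicatively closed set `S`, `L` is unchanged when its argument is conjugated by `g ∈ S`:
right multiplication by `g` permutes the phase classes of `S`, and Haar measure is right invariant.
Neither Schur–Weyl duality nor Weingarten calculus enters.

Tensor products of Hermitian Paulis `E(p)` span all operators. Conjugation by Paulis multiplies such
a product by a sign character, so invariance kills every product unless its indices sum to zero.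

For `k = 2` only `E(p) ⊗ E(p)` remains. If the symplectic matrices act transitively on nonzero
vectors, `L` takes one common value for all `p ≠ 0`. Since `∑ E(p) ⊗ E(p) = 2^m · swap` and the term
`p = 0` is the identity, this value is zero (`linearMap_two_eq_zero`). For the Kerdock groups,
transitivity comes from two kinds of generators: `T_{A_x² W}` makes the second half arbitrary while
the first half is a fixed nonzero vector, because squaring is onto in a finite field of
characteristic two, and `Ω L_{W⁻¹}` interchanges the halves (`eq_of_kerdock_invariant`).

For `k = 3` the surviving terms are `E(p) ⊗ E(q) ⊗ E(p)E(q)`. Transvections, induced by `(1 + i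
E(w))/√2`, are transitive on pairs of distinct nonzero vectors with given symplectic product. There
are thus two unknown values, and the two 3-cycles give two independent equations
(`linearMap_three_eq_zero`).

For an arbitrary lift, the appended random Pauli kills unequal pairs, while on `E(p) ⊗ E(p)` only
`φ(g)` matters; averaging over the group then replaces invariance of the ensemble. Elements of `G`
lift because the generators do: quadratic phases, basis permutations and the Hadamard transform.
Finiteness holds because the Paulis span, so the conjugation action on them determines a unitary up
to phase. -/

theorem kron_sum {κ n σ : Type*} [Fintype κ] [DecidableEq κ] [Fintype σ]
    (A : κ → σ → Matrix n n ℂ) :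
    kron (fun t => ∑ s, A t s) = ∑ p : κ → σ, kron fun t => A t (p t) := by
  ext u v
  simp only [kron, Matrix.of_apply, Matrix.sum_apply, Finset.prod_univ_sum,
    Fintype.piFinset_univ]

theorem kron_smul {κ n : Type*} [Fintype κ] (c : κ → ℂ) (A : κ → Matrix n n ℂ) :
    (kron fun t => c t • A t) = (∏ t, c t) • kron A := by
  ext u v
  simp [kron, Finset.prod_mul_distrib]

theorem kron_single {κ n : Type*} [Fintype κ] [DecidableEq κ] [DecidableEq n] (u v : κ → n) :
    (kron fun t => Matrix.single (u t) (v t) (1 : ℂ)) = Matrix.single u v 1 := by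
  ext x y
  simp only [kron, Matrix.of_apply, Matrix.single_apply]
  split_ifs with h
  · obtain ⟨rfl, rfl⟩ := h
    simp
  · by_contra hne
    exact h ⟨funext fun t => by_contra fun ht => hne (Finset.prod_eq_zero (Finset.mem_univ t)
      (if_neg fun h' => ht h'.1)), funext fun t => by_contra fun ht => hne
      (Finset.prod_eq_zero (Finset.mem_univ t) (if_neg fun h' => ht h'.2))⟩

theorem tensorConj_kron {n : Type*} [Fintype n] (k : ℕ) (U : Matrix n n ℂ)
    (A : Fin k → Matrix n n ℂ) :
    tensorConj k U (kron A) = kron fun t => U * A t * Uᴴ := by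
  simp only [tensorConj, tensorPower, kron_mul]

theorem tensorConj_add {n : Type*} [Fintype n] (k : ℕ) (U : Matrix n n ℂ)
    (X Y : Matrix (Fin k → n) (Fin k → n) ℂ) :
    tensorConj k U (X + Y) = tensorConj k U X + tensorConj k U Y := by
  simp only [tensorConj, mul_add, add_mul]

theorem tensorConj_smul {n : Type*} [Fintype n] (k : ℕ) (U : Matrix n n ℂ) (c : ℂ)
    (X : Matrix (Fin k → n) (Fin k → n) ℂ) :
    tensorConj k U (c • X) = c • tensorConj k U X := by
  simp only [tensorConj, Matrix.mul_smul, Matrix.smul_mul]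

theorem tensorPower_mul {n : Type*} [Fintype n] (k : ℕ) (U V : Matrix n n ℂ) :
    tensorPower k (U * V) = tensorPower k U * tensorPower k V := by
  simp only [tensorPower, kron_mul]

theorem tensorConj_comp {n : Type*} [Fintype n] (k : ℕ) (U V : Matrix n n ℂ)
    (X : Matrix (Fin k → n) (Fin k → n) ℂ) :
    tensorConj k U (tensorConj k V X) = tensorConj k (U * V) X := by
  simp only [tensorConj, Matrix.conjTranspose_mul, tensorPower_mul, Matrix.mul_assoc]

/-- The factor `c^k` cancels its conjugate, so the action descends to phase classes. -/
theorem tensorConj_smul_left {n : Type*} [Fintype n] (k : ℕ) {c : ℂ} (hc : ‖c‖ = 1)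
    (U : Matrix n n ℂ) (X : Matrix (Fin k → n) (Fin k → n) ℂ) :
    tensorConj k (c • U) X = tensorConj k U X := by
  have h : (starRingEnd ℂ) c * c = 1 := by
    rw [← Complex.normSq_eq_conj_mul_self, Complex.normSq_eq_norm_sq, hc]
    norm_num
  simp only [tensorConj, tensorPower, Matrix.conjTranspose_smul]
  rw [kron_smul (fun _ => c) fun _ => U, kron_smul (fun _ => star c) fun _ => Uᴴ]
  simp only [Matrix.smul_mul, Matrix.mul_smul, smul_smul, ← Finset.prod_mul_distrib]
  simp [h]

theorem tensorConj_mul (k : ℕ) (U : Matrix.unitaryGroup n ℂ)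
    (X Y : Matrix (Fin k → n) (Fin k → n) ℂ) :
    tensorConj k (U : Matrix n n ℂ) (X * Y) =
      tensorConj k (U : Matrix n n ℂ) X * tensorConj k (U : Matrix n n ℂ) Y := by
  have h : tensorPower k (U : Matrix n n ℂ)ᴴ * tensorPower k (U : Matrix n n ℂ) = 1 := by
    rw [← tensorPower_mul, ← Matrix.star_eq_conjTranspose, Matrix.UnitaryGroup.star_mul_self,
      tensorPower, kron_one]
  simp only [tensorConj, Matrix.mul_assoc]
  rw [← Matrix.mul_assoc _ (tensorPower k (U : Matrix n n ℂ)) (Y * _), h, Matrix.one_mul]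

/-- The `k`-fold action of a matrix as a linear map. -/
def tensorConjLin {n : Type*} [Fintype n] (k : ℕ) (U : Matrix n n ℂ) :
    Matrix (Fin k → n) (Fin k → n) ℂ →ₗ[ℂ] Matrix (Fin k → n) (Fin k → n) ℂ where
  toFun := tensorConj k U
  map_add' := tensorConj_add k U
  map_smul' := tensorConj_smul k U

/-- The operators on `k` tensor factors that are fixed by the action of every unitary. -/
def unitaryFixed (n : Type*) [Fintype n] [DecidableEq n] (k : ℕ) :
    Subalgebra ℂ (Matrix (Fin k → n) (Fin k → n) ℂ) where
  carrier := {X | ∀ U : Matrix.unitaryGroup n ℂ, tensorConj k (U : Matrix n n ℂ) X = X}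
  mul_mem' hX hY U := by rw [tensorConj_mul, hX U, hY U]
  add_mem' hX hY U := by rw [tensorConj_add, hX U, hY U]
  algebraMap_mem' c U := by
    rw [Algebra.algebraMap_eq_smul_one, tensorConj_smul, ← kron_one, tensorConj_kron]
    simp only [Matrix.mul_one, ← Matrix.star_eq_conjTranspose]
    rw [Matrix.mem_unitaryGroup_iff.mp U.2]

theorem mem_unitaryFixed {k : ℕ} {X : Matrix (Fin k → n) (Fin k → n) ℂ} :
    X ∈ unitaryFixed n k ↔
      ∀ U : Matrix.unitaryGroup n ℂ, tensorConj k (U : Matrix n n ℂ) X = X := Iff.rfl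

/-- The operator that permutes the tensor factors. -/
def permOp (n : Type*) [DecidableEq n] {k : ℕ} (σ : Equiv.Perm (Fin k)) :
    Matrix (Fin k → n) (Fin k → n) ℂ :=
  Matrix.of fun I J => if I = J ∘ σ then 1 else 0

/-- All slots of `U^{⊗k}` carry the same matrix, so permuting the slots commutes with it. -/
theorem permOp_mem_unitaryFixed {k : ℕ} (σ : Equiv.Perm (Fin k)) :
    permOp n σ ∈ unitaryFixed n k := by
  intro U
  have h : tensorPower k (U : Matrix n n ℂ) * permOp n σ =
      permOp n σ * tensorPower k (U : Matrix n n ℂ) := by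
    ext I J
    have h1 : ∀ K : Fin k → n, (I = K ∘ σ) ↔ (K = I ∘ σ.symm) := fun K =>
      ⟨fun h => by rw [h]; ext; simp, fun h => by rw [h]; ext; simp⟩
    simp only [Matrix.mul_apply, permOp, Matrix.of_apply, mul_ite, mul_one, mul_zero,
      ite_mul, one_mul, zero_mul, h1, Finset.sum_ite_eq', Finset.mem_univ, if_true]
    simp only [tensorPower, kron, Matrix.of_apply]
    rw [← Equiv.prod_comp σ.symm]
    simp
  rw [tensorConj, h, Matrix.mul_assoc, ← tensorPower_mul, ← Matrix.star_eq_conjTranspose,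
    Matrix.mem_unitaryGroup_iff.mp U.2, tensorPower, kron_one, Matrix.mul_one]

/-! ### Haar measure and the full twirl -/

instance : IsProbabilityMeasure (unitaryHaar n) :=
  ⟨by
    have := Measure.haarMeasure_self (K₀ := (⊤ : TopologicalSpace.PositiveCompacts
      (Matrix.unitaryGroup n ℂ)))
    simpa [unitaryHaar] using this⟩

instance : (unitaryHaar n).IsHaarMeasure :=
  inferInstanceAs (Measure.haarMeasure _).IsHaarMeasure

/-- Right translation carries the measure to another Haar probability measure, and such a measure is
unique. -/
instance : (unitaryHaar n).IsMulRightInvariant := by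
  constructor
  intro g
  have : (Measure.map (fun x => x * g) (unitaryHaar n)).IsHaarMeasure := inferInstance
  have : IsProbabilityMeasure (Measure.map (fun x => x * g) (unitaryHaar n)) :=
    Measure.isProbabilityMeasure_map (by fun_prop)
  exact Measure.isHaarMeasure_eq_of_isProbabilityMeasure _ _

theorem integrable_tensorConj (k : ℕ) (X : Matrix (Fin k → n) (Fin k → n) ℂ)
    (I J : Fin k → n) :
    Integrable (fun U : Matrix.unitaryGroup n ℂ => tensorConj k (U : Matrix n n ℂ) X I J)
      (unitaryHaar n) := by
  have h : Continuous fun U : Matrix.unitaryGroup n ℂ =>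
      tensorConj k (U : Matrix n n ℂ) X I J := by
    simp only [tensorConj, tensorPower, kron, Matrix.mul_apply, Matrix.of_apply,
      Matrix.conjTranspose_apply]
    have h : ∀ i j, Continuous fun U : Matrix.unitaryGroup n ℂ => (U : Matrix n n ℂ) i j :=
      fun i j => (continuous_subtype_val (p := (· ∈ Matrix.unitaryGroup n ℂ))).matrix_elem i j
    exact continuous_finsetSum _ fun j _ => (continuous_finsetSum _ fun l _ =>
      (continuous_finsetProd _ fun x _ => h _ _).mul continuous_const).mul
        (continuous_finsetProd _ fun x _ => (h _ _).star)
  exact h.integrable_of_hasCompactSupport (HasCompactSupport.of_compactSpace _)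

/-- The full unitary twirl as a linear map. -/
def haarTwirlLin (n : Type*) [Fintype n] [DecidableEq n] (k : ℕ) :
    Matrix (Fin k → n) (Fin k → n) ℂ →ₗ[ℂ] Matrix (Fin k → n) (Fin k → n) ℂ where
  toFun := haarTwirl k
  map_add' X Y := by
    ext I J
    simp only [haarTwirl, Matrix.of_apply, Matrix.add_apply, tensorConj_add]
    exact integral_add (integrable_tensorConj k X I J) (integrable_tensorConj k Y I J)
  map_smul' c X := by
    ext I J
    simp only [haarTwirl, Matrix.of_apply, Matrix.smul_apply, tensorConj_smul, smul_eq_mul,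
      RingHom.id_apply]
    exact integral_const_mul _ _

theorem haarTwirl_of_mem_unitaryFixed {k : ℕ} {X : Matrix (Fin k → n) (Fin k → n) ℂ}
    (hX : X ∈ unitaryFixed n k) : haarTwirl k X = X := by
  ext I J
  simp [haarTwirl, mem_unitaryFixed.mp hX]

theorem haarTwirl_tensorConj (k : ℕ) (V : Matrix.unitaryGroup n ℂ)
    (X : Matrix (Fin k → n) (Fin k → n) ℂ) :
    haarTwirl k (tensorConj k (V : Matrix n n ℂ) X) = haarTwirl k X := by
  ext I J
  simp only [haarTwirl, Matrix.of_apply, tensorConj_comp]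
  exact integral_mul_right_eq_self (μ := unitaryHaar n)
    (fun U : Matrix.unitaryGroup n ℂ => tensorConj k (U : Matrix n n ℂ) X I J) V

/-- The twirl of an ensemble as a linear map. -/
def UnitaryEnsemble.twirlLin {ι : Type*} [Fintype ι] (E : UnitaryEnsemble ι n) (k : ℕ) :
    Matrix (Fin k → n) (Fin k → n) ℂ →ₗ[ℂ] Matrix (Fin k → n) (Fin k → n) ℂ :=
  ∑ i, (E.prob i : ℂ) • tensorConjLin k (E.unitary i : Matrix n n ℂ)

theorem UnitaryEnsemble.twirlLin_apply {ι : Type*} [Fintype ι] (E : UnitaryEnsemble ι n) (k : ℕ)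
    (X : Matrix (Fin k → n) (Fin k → n) ℂ) : E.twirlLin k X = E.twirl k X := by
  simp [UnitaryEnsemble.twirlLin, UnitaryEnsemble.twirl, tensorConjLin]

theorem UnitaryEnsemble.twirl_of_mem_unitaryFixed {ι : Type*} [Fintype ι]
    (E : UnitaryEnsemble ι n) {k : ℕ} {X : Matrix (Fin k → n) (Fin k → n) ℂ}
    (hX : X ∈ unitaryFixed n k) : E.twirl k X = X := by
  have h : ∑ i, (E.prob i : ℂ) = 1 := by exact_mod_cast E.prob_sum
  simp only [UnitaryEnsemble.twirl, mem_unitaryFixed.mp hX, ← Finset.sum_smul, h, one_smul]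

/-- The difference between the twirl of an ensemble and the full unitary twirl. -/
def UnitaryEnsemble.defect {ι : Type*} [Fintype ι] (E : UnitaryEnsemble ι n) (k : ℕ) :
    Matrix (Fin k → n) (Fin k → n) ℂ →ₗ[ℂ] Matrix (Fin k → n) (Fin k → n) ℂ :=
  E.twirlLin k - haarTwirlLin n k

theorem UnitaryEnsemble.defect_apply {ι : Type*} [Fintype ι] (E : UnitaryEnsemble ι n) (k : ℕ)
    (X : Matrix (Fin k → n) (Fin k → n) ℂ) : E.defect k X = E.twirl k X - haarTwirl k X := by
  rw [UnitaryEnsemble.defect, LinearMap.sub_apply, E.twirlLin_apply]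
  rfl

theorem UnitaryEnsemble.defect_of_mem_unitaryFixed {ι : Type*} [Fintype ι]
    (E : UnitaryEnsemble ι n) {k : ℕ} {X : Matrix (Fin k → n) (Fin k → n) ℂ}
    (hX : X ∈ unitaryFixed n k) : E.defect k X = 0 := by
  rw [E.defect_apply, E.twirl_of_mem_unitaryFixed hX, haarTwirl_of_mem_unitaryFixed hX, sub_self]

theorem UnitaryEnsemble.isUnitaryDesign_of_defect {ι : Type*} [Fintype ι]
    (E : UnitaryEnsemble ι n) {k : ℕ} (h : E.defect k = 0) : E.IsUnitaryDesign k := fun X => by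
  have := LinearMap.congr_fun h X
  rwa [E.defect_apply, LinearMap.zero_apply, sub_eq_zero] at this

/-! ## Uniform sampling from a set closed under multiplication -/

/-- The action of a phase class of unitary matrices on `k` tensor factors. -/
def classConj (k : ℕ) (X : Matrix (Fin k → n) (Fin k → n) ℂ) :
    Quotient (phaseSetoid n) → Matrix (Fin k → n) (Fin k → n) ℂ :=
  Quotient.lift (fun U : Matrix.unitaryGroup n ℂ => tensorConj k (U : Matrix n n ℂ) X) <| by
    rintro U V ⟨c, hc, h⟩
    simp only [h, tensorConj_smul_left k hc]

/-- Right multiplication by a unitary matrix on phase classes. -/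
def classMulRight (g : Matrix.unitaryGroup n ℂ) :
    Quotient (phaseSetoid n) → Quotient (phaseSetoid n) :=
  Quotient.map (fun U => U * g) <| by
    rintro U V ⟨c, hc, h⟩
    exact ⟨c, hc, by rw [Matrix.UnitaryGroup.mul_val, Matrix.UnitaryGroup.mul_val, h,
      Matrix.smul_mul]⟩

theorem classMulRight_injective (g : Matrix.unitaryGroup n ℂ) :
    Function.Injective (classMulRight g) := by
  have h : Function.LeftInverse (classMulRight g⁻¹) (classMulRight g) := by
    rintro ⟨U⟩
    exact congrArg (Quotient.mk _) (mul_inv_cancel_right U g)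
  exact h.injective

/-- Group the indices by phase class: the action depends only on the class, and the weights of each
class add up to the uniform one. -/
theorem UnitaryEnsemble.IsUniformOn.twirl_eq {ι : Type*} [Fintype ι] {E : UnitaryEnsemble ι n}
    {S : Set (Matrix.unitaryGroup n ℂ)} (hE : E.IsUniformOn S) (k : ℕ)
    (X : Matrix (Fin k → n) (Fin k → n) ℂ) :
    E.twirl k X = ∑ c ∈ hE.1.toFinset,
      ((1 / ((phaseClasses S).ncard : ℝ) : ℝ) : ℂ) • classConj k X c := by
  classical
  have h1 : ∀ c ∈ hE.1.toFinset,
      ((1 / ((phaseClasses S).ncard : ℝ) : ℝ) : ℂ) • classConj k X c =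
        ∑ i, if Quotient.mk (phaseSetoid n) (E.unitary i) = c then
          (E.prob i : ℂ) • tensorConj k (E.unitary i : Matrix n n ℂ) X else 0 := by
    intro c hc
    rw [← hE.2.2 c (hE.1.mem_toFinset.mp hc), Complex.ofReal_sum, Finset.sum_smul]
    refine Finset.sum_congr rfl fun i _ => ?_
    by_cases h : Quotient.mk (phaseSetoid n) (E.unitary i) = c
    · rw [if_pos h, if_pos h, ← h]
      rfl
    · rw [if_neg h, if_neg h, Complex.ofReal_zero, zero_smul]
  rw [Finset.sum_congr rfl h1, Finset.sum_comm, UnitaryEnsemble.twirl]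
  refine Finset.sum_congr rfl fun i _ => ?_
  rw [Finset.sum_ite_eq]
  -- An index of probability zero may carry a matrix outside `S`, whose class is not in the sum; its
  -- term vanishes anyway.
  by_cases hp : E.prob i = 0
  · simp [hp]
  · rw [if_pos (hE.1.mem_toFinset.mpr ⟨_, hE.2.1 i hp, rfl⟩)]

/-- Right multiplication by `g` is an injective self-map of the finite set of classes, hence a
permutation; closure of `S` under inverses is not needed. -/
theorem UnitaryEnsemble.IsUniformOn.twirl_tensorConj {ι : Type*} [Fintype ι]
    {E : UnitaryEnsemble ι n} {S : Set (Matrix.unitaryGroup n ℂ)} (hE : E.IsUniformOn S)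
    (hS : ∀ g ∈ S, ∀ h ∈ S, g * h ∈ S) (k : ℕ) {g : Matrix.unitaryGroup n ℂ} (hg : g ∈ S)
    (X : Matrix (Fin k → n) (Fin k → n) ℂ) :
    E.twirl k (tensorConj k (g : Matrix n n ℂ) X) = E.twirl k X := by
  have hmap : ∀ c ∈ hE.1.toFinset, classMulRight g c ∈ hE.1.toFinset := by
    intro c hc
    obtain ⟨U, hU, rfl⟩ := hE.1.mem_toFinset.mp hc
    exact hE.1.mem_toFinset.mpr ⟨U * g, hS U hU g hg, rfl⟩
  rw [hE.twirl_eq, hE.twirl_eq]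
  refine Finset.sum_bij (fun c _ => classMulRight g c) hmap
    (fun c _ d _ h => classMulRight_injective g h)
    (fun d hd => ?_) ?_
  · obtain ⟨c, hc, h⟩ := Finset.surj_on_of_inj_on_of_card_le (fun c _ => classMulRight g c) hmap
      (fun c d _ _ h => classMulRight_injective g h) le_rfl d hd
    exact ⟨c, hc, h.symm⟩
  · rintro ⟨U⟩ _
    exact congrArg _ (tensorConj_comp k _ _ X)

theorem UnitaryEnsemble.IsUniformOn.defect_tensorConj {ι : Type*} [Fintype ι]
    {E : UnitaryEnsemble ι n} {S : Set (Matrix.unitaryGroup n ℂ)} (hE : E.IsUniformOn S)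
    (hS : ∀ g ∈ S, ∀ h ∈ S, g * h ∈ S) (k : ℕ) {g : Matrix.unitaryGroup n ℂ} (hg : g ∈ S)
    (X : Matrix (Fin k → n) (Fin k → n) ℂ) :
    E.defect k (tensorConj k (g : Matrix n n ℂ) X) = E.defect k X := by
  rw [E.defect_apply, E.defect_apply, hE.twirl_tensorConj hS k hg, haarTwirl_tensorConj]

end Twirl

/-! ## The algebra of Pauli matrices -/

section Pauli

variable {m : ℕ}

/-- The sign character of `𝔽₂`. -/
def sgn (t : ZMod 2) : ℂ := if t = 0 then 1 else -1

theorem zmodTwo_cases (t : ZMod 2) : t = 0 ∨ t = 1 := by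
  revert t; decide

theorem sgn_zero : sgn 0 = 1 := rfl

theorem sgn_one : sgn 1 = -1 := rfl

theorem sgn_add (s t : ZMod 2) : sgn (s + t) = sgn s * sgn t := by
  rcases zmodTwo_cases s with rfl | rfl <;> rcases zmodTwo_cases t with rfl | rfl <;>
    simp [sgn, show (1 + 1 : ZMod 2) = 0 from rfl]

theorem sgn_mul_self (t : ZMod 2) : sgn t * sgn t = 1 := by
  rcases zmodTwo_cases t with rfl | rfl <;> norm_num [sgn]

theorem sgn_ne_zero (t : ZMod 2) : sgn t ≠ 0 := fun h => by
  have := sgn_mul_self t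
  rw [h, zero_mul] at this
  exact zero_ne_one this

theorem star_sgn (t : ZMod 2) : star (sgn t) = sgn t := by
  rcases zmodTwo_cases t with rfl | rfl <;> simp [sgn]

theorem sgn_injective : Function.Injective sgn := by
  intro s t h
  rcases zmodTwo_cases s with rfl | rfl <;> rcases zmodTwo_cases t with rfl | rfl <;>
    first | rfl | (norm_num [sgn] at h)

theorem sgn_sum {ι : Type*} (s : Finset ι) (f : ι → ZMod 2) :
    sgn (∑ i ∈ s, f i) = ∏ i ∈ s, sgn (f i) := by
  classical
  induction s using Finset.induction_on with
  | empty => simp [sgn_zero]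
  | insert a s ha ih => rw [Finset.sum_insert ha, Finset.prod_insert ha, sgn_add, ih]

theorem I_pow_val_sq (t : ZMod 2) : Complex.I ^ t.val * Complex.I ^ t.val = sgn t := by
  rcases zmodTwo_cases t with rfl | rfl
  · simp [sgn]
  · simp [sgn, ZMod.val_one]

theorem binVec_add_self (a : BinVec m) : a + a = 0 := by
  ext i
  exact CharTwo.add_self_eq_zero _

theorem binVec_eq_add_iff (a b c : BinVec m) : a = b + c ↔ c = a + b := by
  constructor
  · rintro rfl
    rw [add_comm b c, add_assoc, binVec_add_self, add_zero]
  · rintro rfl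
    rw [add_comm a b, ← add_assoc, binVec_add_self, zero_add]

theorem pauliX_pow_mul_pauliZ_pow (a b u v : ZMod 2) :
    (pauliX ^ a.val * pauliZ ^ b.val) u v = if u = v + a then sgn (b * v) else 0 := by
  have h1 : (1 + 1 : ZMod 2) = 0 := rfl
  rw [Matrix.mul_apply]
  have h2 : ∀ f : ZMod 2 → ℂ, ∑ i, f i = f 0 + f 1 := fun f => Fin.sum_univ_two f
  rw [h2]
  rcases zmodTwo_cases a with rfl | rfl <;> rcases zmodTwo_cases b with rfl | rfl <;>
    rcases zmodTwo_cases u with rfl | rfl <;> rcases zmodTwo_cases v with rfl | rfl <;>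
    simp [pauliX, pauliZ, sgn, ZMod.val_one, h1]

theorem pauliD_apply (a b u v : BinVec m) :
    pauliD a b u v = if u = v + a then sgn (b ⬝ᵥ v) else 0 := by
  simp only [pauliD, kron, Matrix.of_apply, pauliX_pow_mul_pauliZ_pow]
  split_ifs with h
  · subst h
    simp [dotProduct, sgn_sum]
  · obtain ⟨i, hi⟩ := Function.ne_iff.mp h
    exact Finset.prod_eq_zero (Finset.mem_univ i) (if_neg hi)

/-- The sign is the cost of moving `Z^b` past `X^c`. -/
theorem pauliD_mul (a b c d : BinVec m) :
    pauliD a b * pauliD c d = sgn (b ⬝ᵥ c) • pauliD (a + c) (b + d) := by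
  ext u v
  simp only [Matrix.mul_apply, pauliD_apply, Matrix.smul_apply, smul_eq_mul, mul_ite, mul_zero,
    Finset.sum_ite_eq', Finset.mem_univ, if_true, ite_mul, zero_mul]
  have h : v + c + a = v + (a + c) := by rw [add_assoc, add_comm c a]
  rw [h, dotProduct_add, add_dotProduct, sgn_add, sgn_add]
  split_ifs
  · ring
  · rfl

theorem pauliD_zero : pauliD (0 : BinVec m) 0 = 1 := by
  ext u v
  simp [pauliD_apply, Matrix.one_apply, sgn_zero]

/-- Binary row vectors `[a, b]` of length `2m`. -/
abbrev PauliIndex (m : ℕ) : Type := BinVec m × BinVec m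

theorem pauliIndex_add_self (p : PauliIndex m) : p + p = 0 :=
  Prod.ext (binVec_add_self _) (binVec_add_self _)

theorem pauliIndex_add_eq_zero {p q : PauliIndex m} : p + q = 0 ↔ p = q := by
  constructor
  · intro h
    calc p = p + (q + q) := by rw [pauliIndex_add_self, add_zero]
      _ = q := by rw [← add_assoc, h, zero_add]
  · rintro rfl
    exact pauliIndex_add_self p

/-- The symplectic form on `𝔽₂^{2m}`. -/
def sympForm (p q : PauliIndex m) : ZMod 2 := p.1 ⬝ᵥ q.2 + p.2 ⬝ᵥ q.1

theorem sympForm_add_left (p q r : PauliIndex m) :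
    sympForm (p + q) r = sympForm p r + sympForm q r := by
  simp only [sympForm, Prod.fst_add, Prod.snd_add, add_dotProduct]
  ring

theorem sympForm_comm (p q : PauliIndex m) : sympForm p q = sympForm q p := by
  simp only [sympForm]
  rw [dotProduct_comm p.1, dotProduct_comm p.2, add_comm]

theorem sympForm_add_right (p q r : PauliIndex m) :
    sympForm p (q + r) = sympForm p q + sympForm p r := by
  rw [sympForm_comm, sympForm_add_left, sympForm_comm q, sympForm_comm r]

theorem sympForm_self (p : PauliIndex m) : sympForm p p = 0 := by
  rw [sympForm, dotProduct_comm p.1]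
  exact CharTwo.add_self_eq_zero _

theorem sympForm_zero_right (p : PauliIndex m) : sympForm p 0 = 0 := by simp [sympForm]

theorem sympForm_zero_left (p : PauliIndex m) : sympForm 0 p = 0 := by simp [sympForm]

/-- Hermitian Pauli matrices, indexed by row vectors of length `2m`. -/
def pauli (p : PauliIndex m) : Matrix (BinVec m) (BinVec m) ℂ := pauliE p.1 p.2

theorem pauli_def (p : PauliIndex m) :
    pauli p = Complex.I ^ (p.1 ⬝ᵥ p.2).val • pauliD p.1 p.2 := rfl

theorem pauli_zero : pauli (0 : PauliIndex m) = 1 := by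
  simp [pauli_def, pauliD_zero]

/-- The phase `i^{ab}` is chosen so that its square cancels the sign of `D(a,b)²`. -/
theorem pauli_mul_self (p : PauliIndex m) : pauli p * pauli p = 1 := by
  rw [pauli_def, Matrix.smul_mul, Matrix.mul_smul, pauliD_mul, binVec_add_self, binVec_add_self,
    pauliD_zero, smul_smul, smul_smul, I_pow_val_sq, dotProduct_comm p.2, sgn_mul_self, one_smul]

theorem I_pow_val_mem (t : ZMod 2) (A : Matrix (BinVec m) (BinVec m) ℂ)
    (hA : A ∈ Matrix.unitaryGroup (BinVec m) ℂ) :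
    Complex.I ^ t.val • A ∈ Matrix.unitaryGroup (BinVec m) ℂ := by
  rw [Matrix.mem_unitaryGroup_iff] at hA ⊢
  rw [star_smul, Matrix.smul_mul, Matrix.mul_smul, smul_smul, hA]
  have h : Complex.I * (starRingEnd ℂ) Complex.I = 1 := by simp
  rw [star_pow, ← mul_pow, show star Complex.I = (starRingEnd ℂ) Complex.I from rfl, h, one_pow,
    one_smul]

theorem pauli_mem (p : PauliIndex m) : pauli p ∈ Matrix.unitaryGroup (BinVec m) ℂ :=
  I_pow_val_mem _ _ (pauliD_mem _ _)

theorem pauli_conjTranspose (p : PauliIndex m) : (pauli p)ᴴ = pauli p := by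
  have h := Matrix.mem_unitaryGroup_iff'.mp (pauli_mem p)
  rw [Matrix.star_eq_conjTranspose] at h
  calc (pauli p)ᴴ = (pauli p)ᴴ * (pauli p * pauli p) := by rw [pauli_mul_self, Matrix.mul_one]
    _ = pauli p := by rw [← Matrix.mul_assoc, h, Matrix.one_mul]

theorem pauliD_eq_smul_pauli (p : PauliIndex m) : ∃ c : ℂ, pauliD p.1 p.2 = c • pauli p :=
  ⟨(Complex.I ^ (p.1 ⬝ᵥ p.2).val)⁻¹, by
    rw [pauli_def, inv_smul_smul₀ (pow_ne_zero _ Complex.I_ne_zero)]⟩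

theorem pauli_mul (p q : PauliIndex m) : ∃ c : ℂ, c ≠ 0 ∧ pauli p * pauli q = c • pauli (p + q) := by
  refine ⟨Complex.I ^ (p.1 ⬝ᵥ p.2).val * Complex.I ^ (q.1 ⬝ᵥ q.2).val * sgn (p.2 ⬝ᵥ q.1) *
    (Complex.I ^ ((p + q).1 ⬝ᵥ (p + q).2).val)⁻¹, ?_, ?_⟩
  · have := sgn_ne_zero (p.2 ⬝ᵥ q.1)
    simp [Complex.I_ne_zero, this]
  · rw [pauli_def, pauli_def, pauli_def, Matrix.smul_mul, Matrix.mul_smul, pauliD_mul, smul_smul,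
      smul_smul, smul_smul, inv_mul_cancel_right₀ (pow_ne_zero _ Complex.I_ne_zero)]
    rfl

theorem pauli_mul_comm (p q : PauliIndex m) :
    pauli p * pauli q = sgn (sympForm p q) • (pauli q * pauli p) := by
  simp only [pauli_def, Matrix.smul_mul, Matrix.mul_smul, pauliD_mul, smul_smul]
  rw [add_comm q.1, add_comm q.2]
  congr 1
  rw [sympForm, sgn_add, dotProduct_comm q.2]
  linear_combination (-(Complex.I ^ (p.1 ⬝ᵥ p.2).val * Complex.I ^ (q.1 ⬝ᵥ q.2).val *
    sgn (p.2 ⬝ᵥ q.1))) * sgn_mul_self (p.1 ⬝ᵥ q.2)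

theorem pauli_conj (p q : PauliIndex m) :
    pauli p * pauli q * (pauli p)ᴴ = sgn (sympForm p q) • pauli q := by
  rw [pauli_mul_comm, pauli_conjTranspose, Matrix.smul_mul, Matrix.mul_assoc, pauli_mul_self,
    Matrix.mul_one]

theorem pauliD_conj (p q : PauliIndex m) :
    pauliD p.1 p.2 * pauli q * (pauliD p.1 p.2)ᴴ = sgn (sympForm p q) • pauli q := by
  have h' : pauliD p.1 p.2 * (pauliD p.1 p.2)ᴴ = 1 :=
    Matrix.mem_unitaryGroup_iff.mp (pauliD_mem p.1 p.2)
  obtain ⟨c, hc⟩ := pauliD_eq_smul_pauli p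
  have h2 : pauliD p.1 p.2 * pauli q = sgn (sympForm p q) • (pauli q * pauliD p.1 p.2) := by
    rw [hc, Matrix.smul_mul, pauli_mul_comm, Matrix.mul_smul, smul_comm]
  rw [h2, Matrix.smul_mul, Matrix.mul_assoc, h', Matrix.mul_one]

/-- The Hermitian Pauli matrices as elements of the unitary group. -/
def pauliU (p : PauliIndex m) : UnitaryN m := ⟨pauli p, pauli_mem p⟩

/-- If `x i = 1`, translating `b` by the `i`-th unit vector flips every term, so the sum is its own
negative. -/
theorem sum_sgn_dotProduct (x : BinVec m) :
    ∑ b : BinVec m, sgn (b ⬝ᵥ x) = if x = 0 then (2 : ℂ) ^ m else 0 := by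
  split_ifs with h
  · subst h
    simp [sgn_zero, ZMod.card]
  · obtain ⟨i, hi⟩ := Function.ne_iff.mp h
    have hi1 : x i = 1 := (zmodTwo_cases (x i)).resolve_left hi
    have key : ∑ b : BinVec m, sgn (b ⬝ᵥ x) = -∑ b : BinVec m, sgn (b ⬝ᵥ x) := by
      conv_lhs => rw [← Equiv.sum_comp (Equiv.addRight (Pi.single i 1))]
      rw [← Finset.sum_neg_distrib]
      refine Finset.sum_congr rfl fun b _ => ?_
      rw [Equiv.coe_addRight, add_dotProduct, sgn_add, single_dotProduct, hi1, mul_one, sgn_one]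
      ring
    linear_combination (1 / 2 : ℂ) * key

theorem exists_sympForm_eq_one {p : PauliIndex m} (hp : p ≠ 0) : ∃ z, sympForm z p = 1 := by
  by_contra hcon
  push Not at hcon
  have h0 : ∀ z, sympForm z p = 0 := fun z => (zmodTwo_cases _).resolve_right (hcon z)
  refine hp (Prod.ext (funext fun i => ?_) (funext fun i => ?_))
  · simpa [sympForm] using h0 (0, Pi.single i 1)
  · simpa [sympForm] using h0 (Pi.single i 1, 0)

/-- Proportional Paulis pick up the same sign under conjugation by every Pauli, and the symplectic
form is nondegenerate. -/
theorem pauli_smul_injective {p q : PauliIndex m} {c : ℂ} (h : pauli p = c • pauli q) : p = q := by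
  by_contra hne
  have hne' : p + q ≠ 0 := fun h' => hne (pauliIndex_add_eq_zero.mp h')
  obtain ⟨z, hz⟩ := exists_sympForm_eq_one hne'
  have h1 : sgn (sympForm z p) • pauli p = sgn (sympForm z q) • pauli p := by
    rw [← pauli_conj, h, Matrix.mul_smul, Matrix.smul_mul, pauli_conj, smul_comm]
  have h2 : sgn (sympForm z p) • (1 : Matrix (BinVec m) (BinVec m) ℂ) =
      sgn (sympForm z q) • 1 := by
    rw [← pauli_mul_self p, ← Matrix.smul_mul, h1, Matrix.smul_mul]
  have h3 := congrFun (congrFun h2 0) 0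
  simp only [Matrix.smul_apply, Matrix.one_apply_eq, smul_eq_mul, mul_one] at h3
  have h4 := sgn_injective h3
  rw [sympForm_add_right, h4] at hz
  rw [CharTwo.add_self_eq_zero] at hz
  exact zero_ne_one hz

/-- Fourier inversion in the `Z`-exponent isolates column `v`; the `X`-part `u + v` sends it to row
`u`. -/
theorem single_eq_sum_pauliD (u v : BinVec m) :
    Matrix.single u v (1 : ℂ) =
      ∑ b : BinVec m, (((2 : ℂ) ^ m)⁻¹ * sgn (b ⬝ᵥ v)) • pauliD (u + v) b := by
  ext x y
  simp only [Matrix.sum_apply, Matrix.smul_apply, pauliD_apply, smul_eq_mul, Matrix.single_apply]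
  have h : ∀ b : BinVec m, ((2 : ℂ) ^ m)⁻¹ * sgn (b ⬝ᵥ v) *
      (if x = y + (u + v) then sgn (b ⬝ᵥ y) else 0) =
      ((2 : ℂ) ^ m)⁻¹ * (if x = y + (u + v) then 1 else 0) * sgn (b ⬝ᵥ (v + y)) := by
    intro b
    rw [dotProduct_add, sgn_add]
    split_ifs <;> ring
  rw [Finset.sum_congr rfl fun b _ => h b, ← Finset.mul_sum, sum_sgn_dotProduct]
  have h2 : (2 : ℂ) ^ m ≠ 0 := pow_ne_zero _ two_ne_zero
  have h3 : v + y = 0 ↔ v = y := by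
    rw [eq_comm, binVec_eq_add_iff, zero_add, eq_comm]
  rw [if_congr h3 rfl rfl]
  by_cases hvy : v = y
  · subst hvy
    have h4 : v + (u + v) = u := by rw [add_comm u v, ← add_assoc, binVec_add_self, zero_add]
    rw [h4]
    by_cases hux : u = x
    · subst hux
      simp [h2]
    · simp [hux, Ne.symm hux]
  · simp [hvy]

theorem exists_sum_pauli (A : Matrix (BinVec m) (BinVec m) ℂ) :
    ∃ c : PauliIndex m → ℂ, A = ∑ p, c p • pauli p := by
  have hA : A ∈ Submodule.span ℂ (Set.range (pauli (m := m))) := by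
    have hD : ∀ p : PauliIndex m, pauliD p.1 p.2 ∈ Submodule.span ℂ (Set.range (pauli (m := m))) := by
      intro p
      obtain ⟨c, hc⟩ := pauliD_eq_smul_pauli p
      rw [hc]
      exact Submodule.smul_mem _ _ (Submodule.subset_span ⟨p, rfl⟩)
    rw [Matrix.matrix_eq_sum_single A]
    refine Submodule.sum_mem _ fun i _ => Submodule.sum_mem _ fun j _ => ?_
    rw [← mul_one (A i j), ← smul_eq_mul, ← Matrix.smul_single, single_eq_sum_pauliD]
    exact Submodule.smul_mem _ _ (Submodule.sum_mem _ fun b _ =>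
      Submodule.smul_mem _ _ (hD (i + j, b)))
  obtain ⟨c, hc⟩ := (Submodule.mem_span_range_iff_exists_fun ℂ).mp hA
  exact ⟨c, hc.symm⟩

/-- A linear map on operators on `k` tensor factors vanishes if it vanishes on the tensor
products of Pauli matrices. -/
theorem linearMap_eq_zero_of_pauli {k : ℕ} {V : Type*} [AddCommGroup V] [Module ℂ V]
    (L : Matrix (Fin k → BinVec m) (Fin k → BinVec m) ℂ →ₗ[ℂ] V)
    (h : ∀ p : Fin k → PauliIndex m, L (kron fun t => pauli (p t)) = 0) : L = 0 := by
  have key : ∀ A : Fin k → Matrix (BinVec m) (BinVec m) ℂ, L (kron A) = 0 := by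
    intro A
    choose c hc using fun t => exists_sum_pauli (A t)
    have : A = fun t => ∑ p, c t p • pauli p := funext hc
    rw [this, kron_sum, map_sum]
    refine Finset.sum_eq_zero fun p _ => ?_
    rw [kron_smul (fun t => c t (p t)) fun t => pauli (p t), map_smul, h, smul_zero]
  refine LinearMap.ext fun X => ?_
  rw [Matrix.matrix_eq_sum_single X, map_sum, LinearMap.zero_apply]
  refine Finset.sum_eq_zero fun I _ => ?_
  rw [map_sum]
  refine Finset.sum_eq_zero fun J _ => ?_
  rw [← mul_one (X I J), ← smul_eq_mul, ← Matrix.smul_single, map_smul, ← kron_single, key,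
    smul_zero]

/-- This is `∑ E(p) ⊗ E(p) = 2^m · swap` in entries. The `X`-parts force `a = u + v = x + y`; the
squared phase is the sign of `a · b`, so the rest is a character sum over `b`. -/
theorem sum_pauli_mul_pauli (u v x y : BinVec m) :
    ∑ p : PauliIndex m, pauli p u v * pauli p x y =
      (2 : ℂ) ^ m * if u = y ∧ x = v then 1 else 0 := by
  have h : ∀ a b : BinVec m, pauli (a, b) u v * pauli (a, b) x y =
      if a = u + v then (if u + v = x + y then sgn (b ⬝ᵥ (u + y)) else 0) else 0 := by
    intro a b
    simp only [pauli_def, Matrix.smul_apply, smul_eq_mul, pauliD_apply, binVec_eq_add_iff u v,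
      binVec_eq_add_iff x y]
    by_cases h1 : a = u + v
    · subst h1
      by_cases h2 : u + v = x + y
      · simp only [h2, if_true]
        have h3 : u + y = x + y + (v + y) := by
          rw [← h2, add_assoc, ← add_assoc v, binVec_add_self, zero_add]
        have h4 : b ⬝ᵥ (u + y) = (x + y) ⬝ᵥ b + b ⬝ᵥ v + b ⬝ᵥ y := by
          rw [h3, dotProduct_add b (x + y), dotProduct_add b v, dotProduct_comm b (x + y), add_assoc]
        rw [h4, sgn_add, sgn_add, ← I_pow_val_sq ((x + y) ⬝ᵥ b)]
        ring
      · simp [h2]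
    · simp [h1]
  rw [Fintype.sum_prod_type]
  simp only [h]
  rw [Finset.sum_comm]
  simp only [Finset.sum_ite_eq', Finset.mem_univ, if_true]
  by_cases h2 : u + v = x + y
  · simp only [if_pos h2, sum_sgn_dotProduct]
    have h3 : u + y = 0 ↔ (u = y ∧ x = v) := by
      constructor
      · intro h4
        have h5 : u = y := by
          have := (binVec_eq_add_iff 0 u y).mp h4.symm
          rw [zero_add] at this
          exact this.symm
        refine ⟨h5, ?_⟩
        rw [h5, add_comm x y] at h2
        exact (add_left_cancel h2).symm
      · rintro ⟨rfl, -⟩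
        exact binVec_add_self _
    rw [if_congr h3 rfl rfl, mul_ite, mul_one, mul_zero]
  · have h3 : ¬ (u = y ∧ x = v) := by
      rintro ⟨rfl, rfl⟩
      exact h2 (add_comm _ _)
    simp [h2, h3]

end Pauli

/-! ## Criteria for linear maps on two and three tensor factors to vanish -/

section Criteria

variable {m : ℕ} {V : Type*} [AddCommGroup V] [Module ℂ V]

theorem eq_zero_of_sum_eq_zero_of_const {ι : Type*} (s : Finset ι) (f : ι → V)
    (hconst : ∀ a ∈ s, ∀ b ∈ s, f a = f b) (hsum : ∑ a ∈ s, f a = 0) : ∀ a ∈ s, f a = 0 := by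
  intro a ha
  rw [Finset.sum_congr rfl fun b hb => hconst b hb a ha, Finset.sum_const,
    ← Nat.cast_smul_eq_nsmul ℂ] at hsum
  exact (smul_eq_zero.mp hsum).resolve_left
    (Nat.cast_ne_zero.mpr (Finset.card_ne_zero_of_mem ha))

theorem sum_kron_pauli_two :
    ∑ p : PauliIndex m, kron ![pauli p, pauli p] =
      (2 : ℂ) ^ m • permOp (BinVec m) (Equiv.swap (0 : Fin 2) 1) := by
  ext I J
  have h : I = J ∘ Equiv.swap (0 : Fin 2) 1 ↔ I 0 = J 1 ∧ I 1 = J 0 := by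
    simp [funext_iff, Fin.forall_fin_two]
  simp only [Matrix.sum_apply, kron, Matrix.of_apply, Fin.prod_univ_two, Matrix.cons_val_zero,
    Matrix.cons_val_one, sum_pauli_mul_pauli, Matrix.smul_apply, permOp, smul_eq_mul]
  rw [if_congr h rfl rfl]

/-- The three ways to place a pair of equal Pauli matrices in three tensor factors. -/
theorem sum_kron_pauli_three_mem :
    ∑ p : PauliIndex m, kron ![pauli p, pauli p, 1] ∈ unitaryFixed (BinVec m) 3 ∧
    ∑ p : PauliIndex m, kron ![pauli p, 1, pauli p] ∈ unitaryFixed (BinVec m) 3 ∧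
    ∑ p : PauliIndex m, kron ![1, pauli p, pauli p] ∈ unitaryFixed (BinVec m) 3 := by
  -- Each of the three sums is `2^m` times the transposition of the two slots that carry the equal
  -- Paulis.
  have key : ∀ (σ : Equiv.Perm (Fin 3)) (f : PauliIndex m → Matrix (Fin 3 → BinVec m) _ ℂ),
      ∑ p, f p = (2 : ℂ) ^ m • permOp (BinVec m) σ →
        ∑ p, f p ∈ unitaryFixed (BinVec m) 3 := by
    intro σ f h
    rw [h]
    exact Subalgebra.smul_mem _ (permOp_mem_unitaryFixed σ) _
  refine ⟨key (Equiv.swap 0 1) _ ?_, key (Equiv.swap 0 2) _ ?_, key (Equiv.swap 1 2) _ ?_⟩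
  · ext I J
    have h : I = J ∘ Equiv.swap (0 : Fin 3) 1 ↔ (I 0 = J 1 ∧ I 1 = J 0) ∧ I 2 = J 2 := by
      simp [funext_iff, Fin.forall_fin_succ, Equiv.swap_apply_def, and_assoc]
    simp only [Matrix.sum_apply, kron, Matrix.of_apply, Fin.prod_univ_three, Matrix.cons_val_zero,
      Matrix.cons_val_one, Matrix.cons_val, Matrix.smul_apply, permOp, smul_eq_mul,
      ← Finset.sum_mul, sum_pauli_mul_pauli, Matrix.one_apply]
    rw [if_congr h rfl rfl, ite_and]
    split_ifs <;> simp_all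
  · ext I J
    have h : I = J ∘ Equiv.swap (0 : Fin 3) 2 ↔ (I 0 = J 2 ∧ I 2 = J 0) ∧ I 1 = J 1 := by
      simp [funext_iff, Fin.forall_fin_succ, Equiv.swap_apply_def]
      tauto
    simp only [Matrix.sum_apply, kron, Matrix.of_apply, Fin.prod_univ_three, Matrix.cons_val_zero,
      Matrix.cons_val_one, Matrix.cons_val, Matrix.smul_apply, permOp, smul_eq_mul]
    rw [Finset.sum_congr rfl fun p _ => mul_right_comm _ _ _, ← Finset.sum_mul,
      sum_pauli_mul_pauli, Matrix.one_apply, if_congr h rfl rfl, ite_and]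
    split_ifs <;> simp_all
  · ext I J
    have h : I = J ∘ Equiv.swap (1 : Fin 3) 2 ↔ (I 1 = J 2 ∧ I 2 = J 1) ∧ I 0 = J 0 := by
      simp [funext_iff, Fin.forall_fin_succ, Equiv.swap_apply_def]
      tauto
    simp only [Matrix.sum_apply, kron, Matrix.of_apply, Fin.prod_univ_three, Matrix.cons_val_zero,
      Matrix.cons_val_one, Matrix.cons_val, Matrix.smul_apply, permOp, smul_eq_mul,
      mul_assoc, ← Finset.mul_sum, sum_pauli_mul_pauli, Matrix.one_apply]
    rw [if_congr h rfl rfl, ite_and]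
    split_ifs <;> simp_all

/-- The identity and the swap are fixed operators; subtracting the term `p = 0` from the swap leaves
a vanishing sum of equal values. -/
theorem linearMap_two_eq_zero
    (L : Matrix (Fin 2 → BinVec m) (Fin 2 → BinVec m) ℂ →ₗ[ℂ] V)
    (hne : ∀ p q : PauliIndex m, p ≠ q → L (kron ![pauli p, pauli q]) = 0)
    (hconst : ∀ p q : PauliIndex m, p ≠ 0 → q ≠ 0 →
      L (kron ![pauli p, pauli p]) = L (kron ![pauli q, pauli q]))
    (hfix : ∀ X ∈ unitaryFixed (BinVec m) 2, L X = 0) : L = 0 := by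
  have h0 : L (kron ![pauli (0 : PauliIndex m), pauli 0]) = 0 := by
    refine hfix _ ?_
    have h1 : (![pauli (0 : PauliIndex m), pauli 0]) = fun _ : Fin 2 => 1 := by
      ext t : 1
      fin_cases t <;> simp [pauli_zero]
    rw [h1, kron_one]
    exact one_mem _
  have hsum : ∑ p : PauliIndex m, L (kron ![pauli p, pauli p]) = 0 := by
    rw [← map_sum, sum_kron_pauli_two]
    exact hfix _ (Subalgebra.smul_mem _ (permOp_mem_unitaryFixed _) _)
  have heq : ∀ p : PauliIndex m, L (kron ![pauli p, pauli p]) = 0 := by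
    intro p
    by_cases hp : p = 0
    · rw [hp, h0]
    refine eq_zero_of_sum_eq_zero_of_const (Finset.univ.erase 0)
      (fun p : PauliIndex m => L (kron ![pauli p, pauli p]))
      (fun a ha b hb => hconst a b (Finset.ne_of_mem_erase ha) (Finset.ne_of_mem_erase hb)) ?_ p
      (Finset.mem_erase.mpr ⟨hp, Finset.mem_univ _⟩)
    rw [← Finset.add_sum_erase _ _ (Finset.mem_univ 0), h0, zero_add] at hsum
    exact hsum
  refine linearMap_eq_zero_of_pauli L fun p => ?_
  have h1 : (fun t => pauli (p t)) = ![pauli (p 0), pauli (p 1)] := by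
    ext t : 1
    fin_cases t <;> rfl
  rw [h1]
  by_cases h : p 0 = p 1
  · rw [h, heq]
  · exact hne _ _ h

/-- Fixed operators form an algebra, and `(P ⊗ 1 ⊗ P)(1 ⊗ Q ⊗ Q) = P ⊗ Q ⊗ PQ`; the reverse order
gives `QP`. Up to a scalar these are the two 3-cycles. -/
theorem sum_pauli_triple_mem :
    ∑ p : PauliIndex m, ∑ q : PauliIndex m, kron ![pauli p, pauli q, pauli p * pauli q] ∈
      unitaryFixed (BinVec m) 3 ∧
    ∑ p : PauliIndex m, ∑ q : PauliIndex m, kron ![pauli p, pauli q, pauli q * pauli p] ∈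
      unitaryFixed (BinVec m) 3 := by
  obtain ⟨-, h2, h3⟩ := sum_kron_pauli_three_mem (m := m)
  have hv : ∀ A B C A' B' C' : Matrix (BinVec m) (BinVec m) ℂ,
      kron ![A, B, C] * kron ![A', B', C'] = kron ![A * A', B * B', C * C'] := by
    intro A B C A' B' C'
    rw [kron_mul]
    congr 1
    ext t : 1
    fin_cases t <;> rfl
  constructor
  · have := mul_mem h2 h3
    simpa only [Finset.sum_mul_sum, hv, Matrix.mul_one, Matrix.one_mul] using this
  · have := mul_mem h3 h2
    rw [Finset.sum_mul_sum, Finset.sum_comm] at this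
    simpa only [hv, Matrix.mul_one, Matrix.one_mul] using this

/-- A linear map on operators on three tensor factors vanishes if it kills the triples of Pauli
matrices with non-scalar product, is constant on the other triples of the same symplectic type,
and kills the operators fixed by all unitaries. -/
theorem linearMap_three_eq_zero
    (L : Matrix (Fin 3 → BinVec m) (Fin 3 → BinVec m) ℂ →ₗ[ℂ] V)
    (hne : ∀ p q r : PauliIndex m, p + q ≠ r → L (kron ![pauli p, pauli q, pauli r]) = 0)
    (hconst₁ : ∀ p q : PauliIndex m, p ≠ 0 → q ≠ 0 →
      L (kron ![pauli p, pauli p, 1]) = L (kron ![pauli q, pauli q, 1]) ∧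
      L (kron ![pauli p, 1, pauli p]) = L (kron ![pauli q, 1, pauli q]) ∧
      L (kron ![1, pauli p, pauli p]) = L (kron ![1, pauli q, pauli q]))
    (hconst₂ : ∀ p q p' q' : PauliIndex m, p ≠ 0 → q ≠ 0 → p ≠ q → p' ≠ 0 → q' ≠ 0 → p' ≠ q' →
      sympForm p q = sympForm p' q' → L (kron ![pauli p, pauli q, pauli p * pauli q]) =
        L (kron ![pauli p', pauli q', pauli p' * pauli q']))
    (hfix : ∀ X ∈ unitaryFixed (BinVec m) 3, L X = 0) : L = 0 := by
  classical
  have hone : kron ![(1 : Matrix (BinVec m) (BinVec m) ℂ), 1, 1] = 1 := by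
    have h1 : ![(1 : Matrix (BinVec m) (BinVec m) ℂ), 1, 1] = fun _ : Fin 3 => 1 := by
      ext t : 1
      fin_cases t <;> rfl
    rw [h1, kron_one]
  have hL1 : L 1 = 0 := hfix _ (one_mem _)
  have hpair : ∀ f : PauliIndex m → Matrix (Fin 3 → BinVec m) (Fin 3 → BinVec m) ℂ, f 0 = 1 →
      (∀ p q, p ≠ 0 → q ≠ 0 → L (f p) = L (f q)) → ∑ p, f p ∈ unitaryFixed (BinVec m) 3 →
        ∀ p, L (f p) = 0 := by
    intro f hf0 hf hmem p
    by_cases hp : p = 0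
    · rw [hp, hf0, hL1]
    refine eq_zero_of_sum_eq_zero_of_const (Finset.univ.erase 0) (fun p => L (f p))
      (fun a ha b hb => hf a b (Finset.ne_of_mem_erase ha) (Finset.ne_of_mem_erase hb)) ?_ p
      (Finset.mem_erase.mpr ⟨hp, Finset.mem_univ _⟩)
    have := hfix _ hmem
    rwa [map_sum, ← Finset.add_sum_erase _ _ (Finset.mem_univ 0), hf0, hL1, zero_add] at this
  obtain ⟨m1, m2, m3⟩ := sum_kron_pauli_three_mem (m := m)
  have e1 := hpair (fun p => kron ![pauli p, pauli p, 1]) (by simp only [pauli_zero, hone])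
    (fun p q hp hq => (hconst₁ p q hp hq).1) m1
  have e2 := hpair (fun p => kron ![pauli p, 1, pauli p]) (by simp only [pauli_zero, hone])
    (fun p q hp hq => (hconst₁ p q hp hq).2.1) m2
  have e3 := hpair (fun p => kron ![1, pauli p, pauli p]) (by simp only [pauli_zero, hone])
    (fun p q hp hq => (hconst₁ p q hp hq).2.2) m3
  -- Putting the product itself in the third slot, instead of `pauli (x.1 + x.2)`, avoids a phase
  -- that would depend on the pair.
  let Y : PauliIndex m × PauliIndex m → V := fun x =>
    L (kron ![pauli x.1, pauli x.2, pauli x.1 * pauli x.2])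
  -- In a degenerate pair one slot becomes the identity, which is one of the cases `e1`, `e2`, `e3`.
  have hdeg : ∀ x : PauliIndex m × PauliIndex m, ¬ (x.1 ≠ 0 ∧ x.2 ≠ 0 ∧ x.1 ≠ x.2) → Y x = 0 := by
    rintro ⟨p, q⟩ hx
    simp only [Y]
    by_cases hp : p = 0
    · rw [hp, pauli_zero, Matrix.one_mul]
      exact e3 q
    by_cases hq : q = 0
    · rw [hq, pauli_zero, Matrix.mul_one]
      exact e2 p
    by_cases hpq : p = q
    · rw [hpq, pauli_mul_self]
      exact e1 q
    exact absurd ⟨hp, hq, hpq⟩ hx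
  obtain ⟨s1, s2⟩ := sum_pauli_triple_mem (m := m)
  have t1 : ∑ x, Y x = 0 := by
    have := hfix _ s1
    rwa [map_sum, Finset.sum_congr rfl fun p _ => map_sum L _ _, ← Fintype.sum_prod_type'] at this
  -- The second 3-cycle has `QP` in the third slot, which differs from `PQ` by the commutation sign.
  have t2 : ∑ x : PauliIndex m × PauliIndex m, sgn (sympForm x.1 x.2) • Y x = 0 := by
    have := hfix _ s2
    rw [map_sum, Finset.sum_congr rfl fun p _ => map_sum L _ _, ← Fintype.sum_prod_type'] at this
    rw [← this]
    refine Finset.sum_congr rfl fun x _ => ?_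
    simp only [Y]
    rw [← map_smul]
    congr 1
    rw [pauli_mul_comm x.2 x.1, sympForm_comm x.2]
    have h : ![pauli x.1, pauli x.2, sgn (sympForm x.1 x.2) • (pauli x.1 * pauli x.2)] =
        fun t => (![1, 1, sgn (sympForm x.1 x.2)] : Fin 3 → ℂ) t •
          (![pauli x.1, pauli x.2, pauli x.1 * pauli x.2] : Fin 3 → _) t := by
      ext t : 1
      fin_cases t <;> simp
    rw [h, kron_smul]
    simp [Fin.prod_univ_three]
  have t3 : ∀ ε : ZMod 2, ∑ x ∈ Finset.univ.filter
      (fun x : PauliIndex m × PauliIndex m => sympForm x.1 x.2 = ε), Y x = 0 := by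
    intro ε
    -- The indicator of `s = ε` is `(1 + sgn ε · sgn s) / 2`, so `t1` and `t2` separate the two
    -- orbit types.
    have h : ∀ x : PauliIndex m × PauliIndex m, (if sympForm x.1 x.2 = ε then Y x else 0) =
        (1 / 2 : ℂ) • Y x + (1 / 2 * sgn ε : ℂ) • (sgn (sympForm x.1 x.2) • Y x) := by
      intro x
      rw [smul_smul, ← add_smul]
      split_ifs with hx
      · rw [hx, mul_assoc, sgn_mul_self]
        norm_num
      · have hx' : sympForm x.1 x.2 = ε + 1 := by
          generalize sympForm x.1 x.2 = s at hx
          revert s ε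
          decide
        rw [hx', sgn_add, ← mul_assoc, mul_assoc (1 / 2 : ℂ), sgn_mul_self, sgn_one]
        norm_num
    rw [Finset.sum_filter, Finset.sum_congr rfl fun x _ => h x, Finset.sum_add_distrib,
      ← Finset.smul_sum, ← Finset.smul_sum, t1, t2, smul_zero, smul_zero, add_zero]
  have hY : ∀ x, Y x = 0 := by
    intro x
    by_cases hx : x.1 ≠ 0 ∧ x.2 ≠ 0 ∧ x.1 ≠ x.2
    · refine eq_zero_of_sum_eq_zero_of_const (Finset.univ.filter
        fun y : PauliIndex m × PauliIndex m =>
          sympForm y.1 y.2 = sympForm x.1 x.2 ∧ (y.1 ≠ 0 ∧ y.2 ≠ 0 ∧ y.1 ≠ y.2)) Y ?_ ?_ x ?_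
      · intro a ha b hb
        obtain ⟨ha, ha1, ha2, ha3⟩ := (Finset.mem_filter.mp ha).2
        obtain ⟨hb, hb1, hb2, hb3⟩ := (Finset.mem_filter.mp hb).2
        exact hconst₂ _ _ _ _ ha1 ha2 ha3 hb1 hb2 hb3 (ha.trans hb.symm)
      · rw [← t3 (sympForm x.1 x.2)]
        refine Finset.sum_subset (fun y hy => ?_) fun y hy hy' => hdeg y fun h => hy' ?_
        · exact Finset.mem_filter.mpr ⟨Finset.mem_univ _, (Finset.mem_filter.mp hy).2.1⟩
        · exact Finset.mem_filter.mpr ⟨Finset.mem_univ _, (Finset.mem_filter.mp hy).2, h⟩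
      · exact Finset.mem_filter.mpr ⟨Finset.mem_univ _, rfl, hx⟩
    · exact hdeg x hx
  refine linearMap_eq_zero_of_pauli L fun p => ?_
  have h1 : (fun t => pauli (p t)) = ![pauli (p 0), pauli (p 1), pauli (p 2)] := by
    ext t : 1
    fin_cases t <;> rfl
  rw [h1]
  by_cases h : p 0 + p 1 = p 2
  · obtain ⟨c, hc, hpq⟩ := pauli_mul (p 0) (p 1)
    have h2 := hY (p 0, p 1)
    simp only [Y, hpq, h] at h2
    have h3 : ![pauli (p 0), pauli (p 1), c • pauli (p 2)] =
        fun t => (![1, 1, c] : Fin 3 → ℂ) t •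
          (![pauli (p 0), pauli (p 1), pauli (p 2)] : Fin 3 → _) t := by
      ext t : 1
      fin_cases t <;> simp
    rw [h3, kron_smul, map_smul] at h2
    refine (smul_eq_zero.mp h2).resolve_left ?_
    simpa [Fin.prod_univ_three] using hc
  · exact hne _ _ _ h

end Criteria

/-! ## Symplectic transvections -/

section Transvection

variable {m : ℕ}

theorem zmodTwo_smul_cases (t : ZMod 2) (p : PauliIndex m) :
    t = 0 ∧ t • p = 0 ∨ t = 1 ∧ t • p = p := by
  rcases zmodTwo_cases t with rfl | rfl
  · exact Or.inl ⟨rfl, zero_smul _ _⟩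
  · exact Or.inr ⟨rfl, one_smul _ _⟩

theorem sympForm_smul_left (c : ZMod 2) (p q : PauliIndex m) :
    sympForm (c • p) q = c * sympForm p q := by
  simp only [sympForm, Prod.smul_fst, Prod.smul_snd, smul_dotProduct, smul_eq_mul, mul_add]

/-- The symplectic transvection `p ↦ p + ⟨p, w⟩ w`. -/
def transvec (w p : PauliIndex m) : PauliIndex m := p + sympForm p w • w

theorem transvec_of_eq_zero {w p : PauliIndex m} (h : sympForm p w = 0) : transvec w p = p := by
  rw [transvec, h, zero_smul, add_zero]

theorem transvec_of_eq_one {w p : PauliIndex m} (h : sympForm p w = 1) : transvec w p = p + w := by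
  rw [transvec, h, one_smul]

theorem transvec_zero (w : PauliIndex m) : transvec w 0 = 0 :=
  transvec_of_eq_zero (sympForm_zero_left w)

theorem zero_transvec (p : PauliIndex m) : transvec 0 p = p :=
  transvec_of_eq_zero (sympForm_zero_right p)

theorem transvec_transvec (w p : PauliIndex m) : transvec w (transvec w p) = p := by
  rcases zmodTwo_cases (sympForm p w) with h | h
  · rw [transvec_of_eq_zero h, transvec_of_eq_zero h]
  · rw [transvec_of_eq_one h, transvec_of_eq_one (by rw [sympForm_add_left, h, sympForm_self,
      add_zero]), add_assoc, pauliIndex_add_self, add_zero]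

theorem transvec_injective (w : PauliIndex m) : Function.Injective (transvec w) :=
  (show Function.LeftInverse (transvec w) (transvec w) from transvec_transvec w).injective

theorem transvec_ne_zero {w p : PauliIndex m} (hp : p ≠ 0) : transvec w p ≠ 0 := fun h =>
  hp (transvec_injective w (h.trans (transvec_zero w).symm))

/-- The two cross terms both equal `⟨p, w⟩⟨q, w⟩` and cancel in characteristic two; the last term
contains `⟨w, w⟩ = 0`. -/
theorem sympForm_transvec (w p q : PauliIndex m) :
    sympForm (transvec w p) (transvec w q) = sympForm p q := by
  simp only [transvec]
  rw [sympForm_add_left, sympForm_add_right, sympForm_smul_left, sympForm_add_right,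
    sympForm_comm p (sympForm q w • w), sympForm_comm w (sympForm q w • w), sympForm_smul_left,
    sympForm_smul_left, sympForm_self, sympForm_comm w p, sympForm_comm w q, add_assoc]
  have h := CharTwo.add_self_eq_zero (sympForm p w * sympForm q w)
  linear_combination h

/-- One transvection thus joins any two non-orthogonal vectors, the basic move in the transitivity
arguments. -/
theorem transvec_add_self {p q : PauliIndex m} (h : sympForm p q = 1) :
    transvec (p + q) p = q := by
  rw [transvec_of_eq_one (by rw [sympForm_add_right, sympForm_self, h, zero_add]), ← add_assoc,
    pauliIndex_add_self, zero_add]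

/-- A consistent system of three linear equations for the symplectic form has a solution. -/
theorem exists_sympForm_eq (u₁ u₂ u₃ : PauliIndex m) (c₁ c₂ c₃ : ZMod 2)
    (h : ∀ s₁ s₂ s₃ : ZMod 2, s₁ • u₁ + s₂ • u₂ + s₃ • u₃ = 0 →
      s₁ * c₁ + s₂ * c₂ + s₃ * c₃ = 0) :
    ∃ z, sympForm u₁ z = c₁ ∧ sympForm u₂ z = c₂ ∧ sympForm u₃ z = c₃ := by
  let Φ : (Fin 3 → ZMod 2) →ₗ[ZMod 2] PauliIndex m :=
    Fintype.linearCombination (ZMod 2) ![u₁, u₂, u₃]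
  let C : Module.Dual (ZMod 2) (Fin 3 → ZMod 2) :=
    Fintype.linearCombination (ZMod 2) ![c₁, c₂, c₃]
  have hΦ : ∀ s, Φ s = s 0 • u₁ + s 1 • u₂ + s 2 • u₃ := fun s => by
    simp [Φ, Fintype.linearCombination_apply, Fin.sum_univ_three]
  have hC : ∀ s, C s = s 0 * c₁ + s 1 * c₂ + s 2 * c₃ := fun s => by
    simp [C, Fintype.linearCombination_apply, Fin.sum_univ_three]
  -- The consistency hypothesis says that `C` kills the kernel of `Φ`, hence factors through `Φ`.
  have hmem : C ∈ LinearMap.range Φ.dualMap := by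
    rw [LinearMap.range_dualMap_eq_dualAnnihilator_ker, Submodule.mem_dualAnnihilator]
    intro s hs
    rw [LinearMap.mem_ker, hΦ] at hs
    rw [hC]
    exact h _ _ _ hs
  obtain ⟨f, hf⟩ := hmem
  have hf' : ∀ s, f (Φ s) = C s := fun s => by rw [← hf]; rfl
  -- Every functional is a pairing with a vector; its halves are exchanged because the form pairs
  -- first halves with second halves.
  have hz : ∀ p, sympForm p (fun i => f (0, Pi.single i 1), fun i => f (Pi.single i 1, 0)) =
      f p := by
    intro p
    have h1 := (f ∘ₗ LinearMap.inl (ZMod 2) (BinVec m) (BinVec m)).pi_apply_eq_sum_univ p.1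
    have h2 := (f ∘ₗ LinearMap.inr (ZMod 2) (BinVec m) (BinVec m)).pi_apply_eq_sum_univ p.2
    have h3 : f p = f (p.1, 0) + f (0, p.2) := by rw [← map_add]; simp
    have h4 : ∀ i : Fin m, (fun j => if i = j then (1 : ZMod 2) else 0) = Pi.single i 1 := by
      intro i
      ext j
      simp [Pi.single_apply, eq_comm]
    simp only [LinearMap.comp_apply, LinearMap.inl_apply, LinearMap.inr_apply, smul_eq_mul,
      h4] at h1 h2
    rw [h3, h1, h2]
    rfl
  refine ⟨(fun i => f (0, Pi.single i 1), fun i => f (Pi.single i 1, 0)), ?_, ?_, ?_⟩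
  · have := hf' ![1, 0, 0]
    rw [hΦ, hC] at this
    rw [hz]
    simpa using this
  · have := hf' ![0, 1, 0]
    rw [hΦ, hC] at this
    rw [hz]
    simpa using this
  · have := hf' ![0, 0, 1]
    rw [hΦ, hC] at this
    rw [hz]
    simpa using this

/-- Orthogonal vectors are joined through some `z` orthogonal to neither. -/
theorem exists_transvec_transvec_eq {p q : PauliIndex m} (hp : p ≠ 0) (hq : q ≠ 0) :
    ∃ w w', transvec w' (transvec w p) = q := by
  by_cases hpq : p = q
  · exact ⟨0, 0, by rw [zero_transvec, zero_transvec, hpq]⟩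
  rcases zmodTwo_cases (sympForm p q) with h | h
  -- Only two equations are needed; the third is the trivial `0 = 0`.
  · obtain ⟨z, h1, h2, -⟩ := exists_sympForm_eq p q 0 1 1 0 (by
      intro s₁ s₂ s₃ hs
      rw [smul_zero, add_zero] at hs
      rcases zmodTwo_smul_cases s₁ p with ⟨rfl, e1⟩ | ⟨rfl, e1⟩ <;>
        rcases zmodTwo_smul_cases s₂ q with ⟨rfl, e2⟩ | ⟨rfl, e2⟩ <;> rw [e1, e2] at hs
      · simp
      · exact absurd (by simpa using hs) hq
      · exact absurd (by simpa using hs) hp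
      · exact absurd (pauliIndex_add_eq_zero.mp hs) hpq)
    exact ⟨p + z, z + q, by
      rw [transvec_add_self h1, transvec_add_self (by rw [sympForm_comm, h2])]⟩
  · exact ⟨p + q, 0, by rw [transvec_add_self h, zero_transvec]⟩

/-- The intermediate `z` is also required to satisfy `⟨u, z⟩ = ⟨u, p⟩`; then `u` is orthogonal to
both transvection vectors `p + z` and `z + q`. -/
theorem exists_transvec_transvec_eq_of_fixed {u p q : PauliIndex m} (hu : u ≠ 0) (hp : p ≠ 0)
    (hq : q ≠ 0) (hup : u ≠ p) (huq : u ≠ q) (h : sympForm u p = sympForm u q) :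
    ∃ w w', transvec w' (transvec w p) = q ∧ transvec w u = u ∧ transvec w' u = u := by
  have hfix : ∀ {a b : PauliIndex m}, sympForm u a = sympForm u b → transvec (a + b) u = u := by
    intro a b hab
    refine transvec_of_eq_zero ?_
    rw [sympForm_add_right, hab]
    exact CharTwo.add_self_eq_zero _
  by_cases hpq : p = q
  · exact ⟨0, 0, by rw [zero_transvec, zero_transvec, hpq], zero_transvec u, zero_transvec u⟩
  rcases zmodTwo_cases (sympForm p q) with h0 | h1
  · obtain ⟨z, h1, h2, h3⟩ := exists_sympForm_eq p q u 1 1 (sympForm u p) (by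
      intro s₁ s₂ s₃ hs
      rcases zmodTwo_smul_cases s₁ p with ⟨rfl, e1⟩ | ⟨rfl, e1⟩ <;>
        rcases zmodTwo_smul_cases s₂ q with ⟨rfl, e2⟩ | ⟨rfl, e2⟩ <;>
        rcases zmodTwo_smul_cases s₃ u with ⟨rfl, e3⟩ | ⟨rfl, e3⟩ <;> rw [e1, e2, e3] at hs
      · simp
      · exact absurd (by simpa using hs) hu
      · exact absurd (by simpa using hs) hq
      · rw [zero_add] at hs
        exact absurd (pauliIndex_add_eq_zero.mp hs).symm huq
      · exact absurd (by simpa using hs) hp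
      · rw [add_zero] at hs
        exact absurd (pauliIndex_add_eq_zero.mp hs).symm hup
      · rw [add_zero] at hs
        exact absurd (pauliIndex_add_eq_zero.mp hs) hpq
      -- The only possible linear relation is `u = p + q`; then `⟨u, p⟩ = ⟨q, p⟩ = 0`, so the system
      -- is still consistent.
      · have h4 : sympForm u p = 0 := by
          rw [← pauliIndex_add_eq_zero.mp hs, sympForm_add_left, sympForm_self, zero_add,
            sympForm_comm, h0]
        rw [h4]
        decide)
    exact ⟨p + z, z + q, by
      rw [transvec_add_self h1, transvec_add_self (by rw [sympForm_comm, h2])],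
      hfix h3.symm, hfix (h3.trans h)⟩
  · exact ⟨p + q, 0, by rw [transvec_add_self h1, zero_transvec], hfix h, zero_transvec u⟩

theorem eq_of_transvec_invariant {V : Type*} {f : PauliIndex m → V}
    (hf : ∀ w p, f (transvec w p) = f p) {p q : PauliIndex m} (hp : p ≠ 0) (hq : q ≠ 0) :
    f p = f q := by
  obtain ⟨w, w', rfl⟩ := exists_transvec_transvec_eq hp hq
  rw [hf, hf]

/-- A Witt-type argument: move `p` to `p'`, then move the image of `q` to `q'` by transvections
fixing `p'`. -/
theorem eq_of_transvec_invariant₂ {V : Type*} {f : PauliIndex m → PauliIndex m → V}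
    (hf : ∀ w p q, f (transvec w p) (transvec w q) = f p q) {p q p' q' : PauliIndex m}
    (hp : p ≠ 0) (hq : q ≠ 0) (hpq : p ≠ q) (hp' : p' ≠ 0) (hq' : q' ≠ 0) (hpq' : p' ≠ q')
    (h : sympForm p q = sympForm p' q') : f p q = f p' q' := by
  obtain ⟨w₁, w₂, h₁⟩ := exists_transvec_transvec_eq hp hp'
  have e₁ : f p q = f p' (transvec w₂ (transvec w₁ q)) := by rw [← h₁, hf, hf]
  have e₂ : sympForm p' (transvec w₂ (transvec w₁ q)) = sympForm p' q' := by
    rw [← h, ← h₁, sympForm_transvec, sympForm_transvec]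
  obtain ⟨w₃, w₄, h₂, h₃, h₄⟩ := exists_transvec_transvec_eq_of_fixed hp'
    (transvec_ne_zero (w := w₂) (transvec_ne_zero (w := w₁) hq)) hq'
    (fun h' => hpq (transvec_injective w₁ (transvec_injective w₂ (h₁.trans h')))) hpq' e₂
  rw [e₁, ← h₂]
  conv_rhs => rw [← h₄, hf, ← h₃, hf]

end Transvection

/-! ## Conjugation of Pauli matrices by Clifford matrices -/

section Conjugation

variable {m : ℕ}

/-- Conjugation by `g` maps one Hermitian Pauli matrix to another one, up to sign. -/
def PauliMaps (g : UnitaryN m) (p q : PauliIndex m) : Prop :=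
  ∃ s : ℂ, s * s = 1 ∧
    (g : Matrix (BinVec m) (BinVec m) ℂ) * pauli p * (g : Matrix _ _ ℂ)ᴴ = s • pauli q

theorem conjTranspose_mul_unitary (g : UnitaryN m) :
    (g : Matrix (BinVec m) (BinVec m) ℂ)ᴴ * (g : Matrix _ _ ℂ) = 1 :=
  Matrix.mem_unitaryGroup_iff'.mp g.2

theorem unitary_mul_conjTranspose (g : UnitaryN m) :
    (g : Matrix (BinVec m) (BinVec m) ℂ) * (g : Matrix _ _ ℂ)ᴴ = 1 :=
  Matrix.mem_unitaryGroup_iff.mp g.2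

theorem conj_mul_conj (g : UnitaryN m) (A B : Matrix (BinVec m) (BinVec m) ℂ) :
    ((g : Matrix (BinVec m) (BinVec m) ℂ) * A * (g : Matrix _ _ ℂ)ᴴ) *
      ((g : Matrix _ _ ℂ) * B * (g : Matrix _ _ ℂ)ᴴ) =
        (g : Matrix _ _ ℂ) * (A * B) * (g : Matrix _ _ ℂ)ᴴ := by
  calc _ = (g : Matrix (BinVec m) (BinVec m) ℂ) * A *
        ((g : Matrix (BinVec m) (BinVec m) ℂ)ᴴ * (g : Matrix _ _ ℂ)) * B *
          (g : Matrix _ _ ℂ)ᴴ := by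
        simp only [Matrix.mul_assoc]
    _ = _ := by rw [conjTranspose_mul_unitary, Matrix.mul_one, Matrix.mul_assoc _ A B]

/-- Conjugates of involutions are involutions, so any proportionality factor between them squares to
one. -/
theorem PauliMaps.of_smul {g : UnitaryN m} {p q : PauliIndex m} {c : ℂ}
    (h : (g : Matrix (BinVec m) (BinVec m) ℂ) * pauli p * (g : Matrix _ _ ℂ)ᴴ = c • pauli q) :
    PauliMaps g p q := by
  refine ⟨c, ?_, h⟩
  have h1 := conj_mul_conj g (pauli p) (pauli p)
  rw [h, pauli_mul_self, Matrix.mul_one, unitary_mul_conjTranspose, Matrix.smul_mul,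
    Matrix.mul_smul, pauli_mul_self, smul_smul] at h1
  have h2 := congrFun (congrFun h1 0) 0
  simpa using h2

theorem PauliMaps.mul {g h : UnitaryN m} {p q r : PauliIndex m} (hg : PauliMaps g q r)
    (hh : PauliMaps h p q) : PauliMaps (g * h) p r := by
  obtain ⟨s, -, hs⟩ := hg
  obtain ⟨t, -, ht⟩ := hh
  refine PauliMaps.of_smul (c := t * s) ?_
  calc _ = (g : Matrix (BinVec m) (BinVec m) ℂ) * ((h : Matrix _ _ ℂ) * pauli p *
        (h : Matrix _ _ ℂ)ᴴ) * (g : Matrix _ _ ℂ)ᴴ := by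
        simp only [Matrix.UnitaryGroup.mul_val, Matrix.conjTranspose_mul, Matrix.mul_assoc]
    _ = _ := by rw [ht, Matrix.mul_smul, Matrix.smul_mul, hs, smul_smul]

theorem PauliMaps.inv {g : UnitaryN m} {p q : PauliIndex m} (hg : PauliMaps g p q) :
    PauliMaps g⁻¹ q p := by
  obtain ⟨s, hs, h⟩ := hg
  refine PauliMaps.of_smul (c := s) ?_
  have h1 : pauli q = s • ((g : Matrix (BinVec m) (BinVec m) ℂ) * pauli p *
      (g : Matrix _ _ ℂ)ᴴ) := by
    rw [h, smul_smul, hs, one_smul]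
  have h2 : ((g⁻¹ : UnitaryN m) : Matrix (BinVec m) (BinVec m) ℂ) = (g : Matrix _ _ ℂ)ᴴ := rfl
  rw [h1, h2, Matrix.conjTranspose_conjTranspose, Matrix.mul_smul, Matrix.smul_mul]
  congr 1
  calc _ = (g : Matrix (BinVec m) (BinVec m) ℂ)ᴴ * (g : Matrix _ _ ℂ) * pauli p *
        ((g : Matrix (BinVec m) (BinVec m) ℂ)ᴴ * (g : Matrix _ _ ℂ)) := by
        simp only [Matrix.mul_assoc]
    _ = _ := by rw [conjTranspose_mul_unitary, Matrix.mul_one, Matrix.one_mul]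

theorem PauliMaps.eq {g : UnitaryN m} {p q r : PauliIndex m} (hq : PauliMaps g p q)
    (hr : PauliMaps g p r) : q = r := by
  obtain ⟨s, hs, h⟩ := hq
  obtain ⟨t, -, h'⟩ := hr
  refine pauli_smul_injective (c := s * t) ?_
  rw [mul_smul, ← h', h, smul_smul, hs, one_smul]

theorem mem_cliffordGroup_of_pauliMaps {g : UnitaryN m} (h : ∀ p, ∃ q, PauliMaps g p q) :
    g ∈ cliffordGroup m := by
  intro a b
  obtain ⟨q, s, hs, hq⟩ := h (a, b)
  have hs' : ∃ k : ℕ, s = Complex.I ^ k := by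
    have h1 : (s - 1) * (s + 1) = 0 := by linear_combination hs
    rcases mul_eq_zero.mp h1 with h2 | h2
    · exact ⟨0, by rw [pow_zero]; linear_combination h2⟩
    · exact ⟨2, by rw [Complex.I_sq]; linear_combination h2⟩
  obtain ⟨k, rfl⟩ := hs'
  obtain ⟨i, hi⟩ : ∃ i : ℕ, pauliD a b = Complex.I ^ i • pauli (a, b) := by
    -- The exponent 3 is `-1` modulo 4, so this undoes the phase in `pauliE`.
    refine ⟨(a ⬝ᵥ b).val * 3, ?_⟩
    rw [pauli_def, smul_smul, ← pow_add,
      show (a ⬝ᵥ b).val * 3 + ((a, b).1 ⬝ᵥ (a, b).2).val = 4 * (a ⬝ᵥ b).val by ring, pow_mul,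
      Complex.I_pow_four, one_pow, one_smul]
  refine ⟨⟨(i + k + (q.1 ⬝ᵥ q.2).val) % 4, Nat.mod_lt _ (by norm_num)⟩, q.1, q.2, ?_⟩
  rw [hi, Matrix.mul_smul, Matrix.smul_mul, hq, pauli_def, smul_smul, smul_smul]
  simp only [← Complex.I_pow_eq_pow_mod, pow_add, mul_assoc]

theorem cliffordGroup_mul {g h : UnitaryN m} (hg : g ∈ cliffordGroup m)
    (hh : h ∈ cliffordGroup m) : g * h ∈ cliffordGroup m := by
  intro a b
  obtain ⟨κ, a', b', h1⟩ := hh a b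
  obtain ⟨κ', a'', b'', h2⟩ := hg a' b'
  refine ⟨⟨((κ : ℕ) + κ') % 4, Nat.mod_lt _ (by norm_num)⟩, a'', b'', ?_⟩
  calc _ = (g : Matrix (BinVec m) (BinVec m) ℂ) * ((h : Matrix _ _ ℂ) * pauliD a b *
        (h : Matrix _ _ ℂ)ᴴ) * (g : Matrix _ _ ℂ)ᴴ := by
        simp only [Matrix.UnitaryGroup.mul_val, Matrix.conjTranspose_mul, Matrix.mul_assoc]
    _ = _ := by
      rw [h1, Matrix.mul_smul, Matrix.smul_mul, h2, smul_smul]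
      simp only [← Complex.I_pow_eq_pow_mod, pow_add]

theorem pauliMaps_pauliU (p q : PauliIndex m) : PauliMaps (pauliU p) q q :=
  PauliMaps.of_smul (pauli_conj p q)

theorem pauliU_mem_cliffordGroup (p : PauliIndex m) : pauliU p ∈ cliffordGroup m :=
  mem_cliffordGroup_of_pauliMaps fun q => ⟨q, pauliMaps_pauliU p q⟩

/-- For every symplectic transvection there is a Clifford matrix that induces it. -/
theorem exists_clifford_transvec (w : PauliIndex m) :
    ∃ g ∈ cliffordGroup m, ∀ p, PauliMaps g p (transvec w p) := by
  let r : ℂ := ((Real.sqrt 2 : ℝ) : ℂ)⁻¹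
  have hr : r * r = 1 / 2 := by
    rw [← mul_inv, ← Complex.ofReal_mul, Real.mul_self_sqrt (by norm_num)]
    norm_num
  have hr' : star r = r := by
    simp only [r, star_inv₀]
    rw [show star ((Real.sqrt 2 : ℝ) : ℂ) = _ from Complex.conj_ofReal _]
  -- This is `exp(iπ E(w)/4)`: it fixes the Paulis commuting with `E(w)` and sends an anticommuting
  -- `E(p)` to `-i E(p)E(w)`.
  let A : Matrix (BinVec m) (BinVec m) ℂ := r • (1 + Complex.I • pauli w)
  have hA : Aᴴ = r • (1 - Complex.I • pauli w) := by
    simp only [A, Matrix.conjTranspose_smul, Matrix.conjTranspose_add, Matrix.conjTranspose_one,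
      pauli_conjTranspose, hr']
    rw [show star Complex.I = -Complex.I from Complex.conj_I, neg_smul, sub_eq_add_neg]
  have hI : Complex.I * Complex.I = -1 := Complex.I_mul_I
  have key : ∀ B, A * B * Aᴴ = (1 / 2 : ℂ) • (B + Complex.I • (pauli w * B) -
      Complex.I • (B * pauli w) + pauli w * B * pauli w) := by
    intro B
    rw [hA]
    have e1 : r * (r * Complex.I) = 1 / 2 * Complex.I := by rw [← hr]; ring
    have e2 : r * Complex.I * r = 1 / 2 * Complex.I := by rw [← hr]; ring
    have e3 : r * Complex.I * (r * Complex.I) = -(1 / 2) := by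
      rw [← hr, mul_mul_mul_comm, hI]
      ring
    simp only [A, Matrix.smul_mul, Matrix.mul_smul, smul_smul, hr, add_mul, mul_sub,
      Matrix.one_mul, Matrix.mul_one, smul_sub, smul_add, e1, e2, e3]
    rw [neg_smul]
    abel
  have hU : A ∈ Matrix.unitaryGroup (BinVec m) ℂ := by
    have h := key 1
    simp only [Matrix.mul_one, Matrix.one_mul, pauli_mul_self] at h
    rw [Matrix.mem_unitaryGroup_iff, Matrix.star_eq_conjTranspose, h]
    rw [add_sub_cancel_right, ← two_smul ℂ, smul_smul]
    norm_num
  have hmaps : ∀ p, PauliMaps ⟨A, hU⟩ p (transvec w p) := by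
    intro p
    rcases zmodTwo_cases (sympForm p w) with h | h
    · rw [transvec_of_eq_zero h]
      refine PauliMaps.of_smul (c := 1) ((key _).trans ?_)
      rw [pauli_mul_comm p w, h, sgn_zero, one_smul, add_sub_cancel_right, pauli_mul_comm w p,
        sympForm_comm, h, sgn_zero, one_smul, Matrix.mul_assoc, pauli_mul_self, Matrix.mul_one,
        ← two_smul ℂ, smul_smul]
      norm_num
    · rw [transvec_of_eq_one h]
      obtain ⟨c, -, hc⟩ := pauli_mul p w
      refine PauliMaps.of_smul (c := -Complex.I * c) ((key _).trans ?_)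
      rw [pauli_mul_comm w p, sympForm_comm, h, sgn_one, neg_one_smul, Matrix.neg_mul,
        Matrix.mul_assoc, pauli_mul_self, Matrix.mul_one, hc]
      module
  exact ⟨⟨A, hU⟩, mem_cliffordGroup_of_pauliMaps fun p => ⟨_, hmaps p⟩, hmaps⟩

end Conjugation

/-! ## Lifting symplectic matrices to Clifford matrices -/

section Lift

variable {m : ℕ}

/-- The action of `2m × 2m` matrices on row vectors `[a, b]`. -/
def rowAct (F : BlockMatrix m) (p : PauliIndex m) : PauliIndex m :=
  ((Sum.elim p.1 p.2 ᵥ* F) ∘ Sum.inl, (Sum.elim p.1 p.2 ᵥ* F) ∘ Sum.inr)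

theorem rowAct_mul (F F' : BlockMatrix m) (p : PauliIndex m) :
    rowAct (F * F') p = rowAct F' (rowAct F p) := by
  simp only [rowAct, Sum.elim_comp_inl_inr, Matrix.vecMul_vecMul]

theorem rowAct_one (p : PauliIndex m) : rowAct 1 p = p := by
  simp [rowAct]

theorem rowAct_injective_left {F F' : BlockMatrix m} (h : ∀ p, rowAct F p = rowAct F' p) :
    F = F' := by
  have hv : ∀ v, v ᵥ* F = v ᵥ* F' := by
    intro v
    have h1 := h (v ∘ Sum.inl, v ∘ Sum.inr)
    simp only [rowAct, Sum.elim_comp_inl_inr] at h1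
    rw [← Sum.elim_comp_inl_inr (v ᵥ* F), ← Sum.elim_comp_inl_inr (v ᵥ* F'), (Prod.mk.inj h1).1,
      (Prod.mk.inj h1).2]
  ext i j
  have := congrFun (hv (Pi.single i 1)) j
  simpa using this

theorem rowAct_inv_rowAct (F : SpBinary m) (p : PauliIndex m) :
    rowAct ((F⁻¹ : SpBinary m) : BlockMatrix m) (rowAct (F : BlockMatrix m) p) = p := by
  rw [← rowAct_mul, ← Submonoid.coe_mul, mul_inv_cancel, Submonoid.coe_one, rowAct_one]

theorem rowAct_rowAct_inv (F : SpBinary m) (p : PauliIndex m) :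
    rowAct (F : BlockMatrix m) (rowAct ((F⁻¹ : SpBinary m) : BlockMatrix m) p) = p := by
  rw [← rowAct_mul, ← Submonoid.coe_mul, inv_mul_cancel, Submonoid.coe_one, rowAct_one]

theorem inducesSymplectic_iff {g : UnitaryN m} {F : BlockMatrix m} :
    InducesSymplectic g F ↔ ∀ p, PauliMaps g p (rowAct F p) := by
  constructor
  · intro h p
    rcases h p.1 p.2 with h | h
    · exact ⟨1, by norm_num, by rw [one_smul]; exact h⟩
    · exact ⟨-1, by norm_num, by rw [neg_one_smul]; exact h⟩
  · intro h a b
    obtain ⟨s, hs, h⟩ := h (a, b)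
    rcases mul_self_eq_one_iff.mp hs with rfl | rfl
    · left
      rw [one_smul] at h
      exact h
    · right
      rw [neg_one_smul] at h
      exact h

theorem InducesSymplectic.mem_cliffordGroup {g : UnitaryN m} {F : BlockMatrix m}
    (h : InducesSymplectic g F) : g ∈ cliffordGroup m :=
  mem_cliffordGroup_of_pauliMaps fun p => ⟨_, inducesSymplectic_iff.mp h p⟩

/-- The order is reversed because symplectic matrices act on row vectors. -/
theorem InducesSymplectic.mul {g h : UnitaryN m} {F F' : BlockMatrix m}
    (hg : InducesSymplectic g F) (hh : InducesSymplectic h F') :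
    InducesSymplectic (g * h) (F' * F) := by
  rw [inducesSymplectic_iff] at *
  intro p
  rw [rowAct_mul]
  exact (hg _).mul (hh p)

theorem InducesSymplectic.eq {g : UnitaryN m} {F F' : BlockMatrix m}
    (h : InducesSymplectic g F) (h' : InducesSymplectic g F') : F = F' :=
  rowAct_injective_left fun p =>
    (inducesSymplectic_iff.mp h p).eq (inducesSymplectic_iff.mp h' p)

theorem inducesSymplectic_pauliU (p : PauliIndex m) : InducesSymplectic (pauliU p) 1 := by
  rw [inducesSymplectic_iff]
  intro q
  rw [rowAct_one]
  exact pauliMaps_pauliU p q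

/-- An intertwining relation can be checked entry by entry, and its scalar need not be controlled.
-/
theorem PauliMaps.of_commute {g : UnitaryN m} {p q : PauliIndex m} {c : ℂ}
    (h : (g : Matrix (BinVec m) (BinVec m) ℂ) * pauliD p.1 p.2 =
      c • (pauliD q.1 q.2 * (g : Matrix _ _ ℂ))) : PauliMaps g p q := by
  obtain ⟨d, hd⟩ := pauliD_eq_smul_pauli q
  refine PauliMaps.of_smul (c := Complex.I ^ (p.1 ⬝ᵥ p.2).val * (c * d)) ?_
  rw [pauli_def p, Matrix.mul_smul, h, Matrix.smul_mul, Matrix.smul_mul, Matrix.mul_assoc,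
    unitary_mul_conjTranspose, Matrix.mul_one, hd, smul_smul, smul_smul, mul_assoc]

/-- Powers of the imaginary unit, with exponents modulo 4. -/
def ipow (t : ZMod 4) : ℂ := Complex.I ^ t.val

theorem ipow_add (s t : ZMod 4) : ipow (s + t) = ipow s * ipow t := by
  rw [ipow, ZMod.val_add, ← Complex.I_pow_eq_pow_mod, pow_add, ipow, ipow]

theorem star_ipow_mul_ipow (t : ZMod 4) : ipow t * star (ipow t) = 1 := by
  have h : Complex.I * (starRingEnd ℂ) Complex.I = 1 := by simp
  rw [ipow, star_pow, ← mul_pow, show star Complex.I = (starRingEnd ℂ) Complex.I from rfl, h,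
    one_pow]

/-- The lift `0 ↦ 0`, `1 ↦ 1` from integers modulo 2 to integers modulo 4. -/
def liftFour (t : ZMod 2) : ZMod 4 := (t.val : ZMod 4)

theorem liftFour_add (s t : ZMod 2) : liftFour (s + t) =
    liftFour s + liftFour t + (liftFour s * liftFour t + liftFour s * liftFour t) := by
  revert s t
  decide

theorem liftFour_mul (s t : ZMod 2) : liftFour (s * t) = liftFour s * liftFour t := by
  revert s t
  decide

/-- The lift is additive only modulo 2; doubling removes the discrepancy modulo 4. -/
theorem two_mul_liftFour_sum {ι : Type*} (s : Finset ι) (f : ι → ZMod 2) :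
    2 * liftFour (∑ i ∈ s, f i) = 2 * ∑ i ∈ s, liftFour (f i) := by
  classical
  induction s using Finset.induction_on with
  | empty => rfl
  | insert a s ha ih =>
    rw [Finset.sum_insert ha, Finset.sum_insert ha, mul_add, ← ih]
    generalize ∑ i ∈ s, f i = x
    generalize f a = y
    revert x y
    decide

theorem ipow_two_mul_liftFour (t : ZMod 2) : ipow (2 * liftFour t) = sgn t := by
  rcases zmodTwo_cases t with rfl | rfl
  · simp [ipow, liftFour, sgn]
  · rw [show (2 * liftFour 1 : ZMod 4) = 2 from rfl, ipow, show (2 : ZMod 4).val = 2 from rfl,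
      Complex.I_sq, sgn_one]

/-- The quadratic form `x P xᵀ` with values in the integers modulo 4. -/
def quadFour (P : Matrix (Fin m) (Fin m) (ZMod 2)) (x : BinVec m) : ZMod 4 :=
  (liftFour ∘ x) ⬝ᵥ (P.map liftFour *ᵥ (liftFour ∘ x))

/-- Polarization: the lift of `x + a` exceeds the sum of the lifts by twice their product, and by
symmetry of `P` this contributes only multiples of 4. -/
theorem quadFour_add {P : Matrix (Fin m) (Fin m) (ZMod 2)} (hP : P.IsSymm) (x a : BinVec m) :
    quadFour P (x + a) =
      quadFour P x + quadFour P a + 2 * liftFour ((a ᵥ* P) ⬝ᵥ x) := by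
  have hsym : ∀ u v : Fin m → ZMod 4,
      u ⬝ᵥ (P.map liftFour *ᵥ v) = v ⬝ᵥ (P.map liftFour *ᵥ u) := by
    intro u v
    have h : (P.map liftFour)ᵀ = P.map liftFour := by rw [← Matrix.transpose_map, hP.eq]
    rw [Matrix.dotProduct_mulVec, ← Matrix.mulVec_transpose, h, dotProduct_comm]
  have hadd : liftFour ∘ (x + a) = liftFour ∘ x + liftFour ∘ a +
      ((liftFour ∘ x) * (liftFour ∘ a) + (liftFour ∘ x) * (liftFour ∘ a)) := by
    ext i
    exact liftFour_add _ _
  have hmix : 2 * liftFour ((a ᵥ* P) ⬝ᵥ x) =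
      2 * ((liftFour ∘ a) ⬝ᵥ (P.map liftFour *ᵥ (liftFour ∘ x))) := by
    rw [← Matrix.dotProduct_mulVec]
    simp only [dotProduct, Matrix.mulVec, Finset.mul_sum, two_mul_liftFour_sum, liftFour_mul,
      Matrix.map_apply, Function.comp_apply]
  rw [hmix]
  simp only [quadFour]
  rw [hadd]
  generalize liftFour ∘ x = u
  generalize liftFour ∘ a = v
  generalize u * v = w
  simp only [add_dotProduct, Matrix.mulVec_add, dotProduct_add]
  rw [hsym u v, hsym w u, hsym w v]
  have h4 : (4 : ZMod 4) = 0 := rfl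
  linear_combination (u ⬝ᵥ (P.map liftFour *ᵥ w) + v ⬝ᵥ (P.map liftFour *ᵥ w) +
    w ⬝ᵥ (P.map liftFour *ᵥ w)) * h4

/-! ### Clifford matrices inducing `T_P`, `L_Q` and `Ω` -/

theorem rowAct_sympT (P : Matrix (Fin m) (Fin m) (ZMod 2)) (p : PauliIndex m) :
    rowAct (sympT P) p = (p.1, p.1 ᵥ* P + p.2) := by
  simp [rowAct, sympT, Matrix.vecMul_fromBlocks]

theorem rowAct_sympL (Q : Matrix (Fin m) (Fin m) (ZMod 2)) (p : PauliIndex m) :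
    rowAct (sympL Q) p = (p.1 ᵥ* Q, p.2 ᵥ* Q⁻¹ᵀ) := by
  simp [rowAct, sympL, Matrix.vecMul_fromBlocks]

theorem rowAct_sympOmega (p : PauliIndex m) : rowAct (sympOmega m) p = (p.2, p.1) := by
  simp [rowAct, sympOmega, Matrix.vecMul_fromBlocks]

/-- For the diagonal matrix of phases `i^{xPxᵀ}`, the ratio of the entries at `v + a` and `v` is a
constant times the character `aP` of `v`, which is added to the `Z`-part. -/
theorem exists_induces_sympT {P : Matrix (Fin m) (Fin m) (ZMod 2)} (hP : P.IsSymm) :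
    ∃ g : UnitaryN m, InducesSymplectic g (sympT P) := by
  have hU : Matrix.diagonal (fun x => ipow (quadFour P x)) ∈
      Matrix.unitaryGroup (BinVec m) ℂ := by
    rw [Matrix.mem_unitaryGroup_iff, Matrix.star_eq_conjTranspose,
      Matrix.diagonal_conjTranspose, Matrix.diagonal_mul_diagonal, ← Matrix.diagonal_one]
    congr 1
    ext x
    exact star_ipow_mul_ipow _
  refine ⟨⟨_, hU⟩, inducesSymplectic_iff.mpr fun p => ?_⟩
  rw [rowAct_sympT]
  refine PauliMaps.of_commute (c := ipow (quadFour P p.1)) ?_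
  ext u v
  simp only [Matrix.diagonal_mul, Matrix.smul_apply, Matrix.mul_diagonal, pauliD_apply,
    smul_eq_mul]
  split_ifs with h
  · rw [h, quadFour_add hP, ipow_add, ipow_add, ipow_two_mul_liftFour, add_dotProduct, sgn_add]
    ring
  · simp

/-- The permutation `e_x ↦ e_{xQ}` transforms translations by `Q` and characters by the inverse
transpose. -/
theorem exists_induces_sympL {Q : Matrix (Fin m) (Fin m) (ZMod 2)} (hQ : IsUnit Q.det) :
    ∃ g : UnitaryN m, InducesSymplectic g (sympL Q) := by
  have hinj : ∀ u v : BinVec m, u ᵥ* Q = v ᵥ* Q ↔ u = v := fun u v =>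
    ⟨fun h => by
      have := congrArg (· ᵥ* Q⁻¹) h
      simpa [Matrix.vecMul_vecMul, Matrix.mul_nonsing_inv _ hQ] using this, fun h => by rw [h]⟩
  have hU : Matrix.of (fun u x : BinVec m => if u = x ᵥ* Q then (1 : ℂ) else 0) ∈
      Matrix.unitaryGroup (BinVec m) ℂ := by
    rw [Matrix.mem_unitaryGroup_iff']
    ext u v
    simp only [Matrix.mul_apply, Matrix.star_apply, Matrix.of_apply, apply_ite star, star_one,
      star_zero, ite_mul, one_mul, zero_mul, Finset.sum_ite_eq', Finset.mem_univ, if_true,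
      Matrix.one_apply, hinj]
  refine ⟨⟨_, hU⟩, inducesSymplectic_iff.mpr fun p => ?_⟩
  rw [rowAct_sympL]
  refine PauliMaps.of_commute (c := 1) ?_
  ext u v
  have h1 : (p.2 ᵥ* Q⁻¹ᵀ) ⬝ᵥ (v ᵥ* Q) = p.2 ⬝ᵥ v := by
    rw [← Matrix.dotProduct_mulVec, Matrix.mulVec_transpose, Matrix.vecMul_vecMul,
      Matrix.mul_nonsing_inv _ hQ, Matrix.vecMul_one]
  simp only [one_smul, Matrix.mul_apply, Matrix.of_apply, pauliD_apply, mul_ite, mul_one,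
    mul_zero, Finset.sum_ite_eq', Finset.mem_univ, if_true, h1, Matrix.add_vecMul, ite_mul,
    one_mul, zero_mul]

/-- The normalized Walsh–Hadamard matrix exchanges translations and characters. -/
theorem exists_induces_sympOmega :
    ∃ g : UnitaryN m, InducesSymplectic g (sympOmega m) := by
  let r : ℂ := ((Real.sqrt (2 ^ m) : ℝ) : ℂ)⁻¹
  have hr : r * r * 2 ^ m = 1 := by
    rw [← mul_inv, ← Complex.ofReal_mul, Real.mul_self_sqrt (by positivity)]
    push_cast
    exact inv_mul_cancel₀ (pow_ne_zero _ two_ne_zero)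
  have hr' : star r = r := by
    simp only [r, star_inv₀]
    rw [show star ((Real.sqrt (2 ^ m) : ℝ) : ℂ) = _ from Complex.conj_ofReal _]
  have hU : Matrix.of (fun u v : BinVec m => r * sgn (u ⬝ᵥ v)) ∈
      Matrix.unitaryGroup (BinVec m) ℂ := by
    rw [Matrix.mem_unitaryGroup_iff]
    ext u v
    have h : ∀ w : BinVec m, r * sgn (u ⬝ᵥ w) * star (r * sgn (v ⬝ᵥ w)) =
        r * r * sgn (w ⬝ᵥ (u + v)) := by
      intro w
      rw [star_mul', hr', star_sgn, dotProduct_add, sgn_add, dotProduct_comm w, dotProduct_comm w]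
      ring
    simp only [Matrix.mul_apply, Matrix.star_apply, Matrix.of_apply, h]
    rw [← Finset.mul_sum, sum_sgn_dotProduct, Matrix.one_apply, mul_ite, hr, mul_zero]
    refine if_congr ?_ rfl rfl
    rw [eq_comm, binVec_eq_add_iff, zero_add, eq_comm]
  refine ⟨⟨_, hU⟩, inducesSymplectic_iff.mpr fun p => ?_⟩
  rw [rowAct_sympOmega]
  refine PauliMaps.of_commute (c := sgn (p.1 ⬝ᵥ p.2)) ?_
  ext u v
  simp only [Matrix.smul_apply, Matrix.mul_apply, Matrix.of_apply, pauliD_apply, mul_ite,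
    mul_zero, Finset.sum_ite_eq', Finset.mem_univ, if_true, ite_mul, zero_mul,
    binVec_eq_add_iff u, smul_eq_mul]
  rw [Finset.sum_congr rfl fun w _ => if_congr (show p.2 = u + w ↔ w = u + p.2 by
    rw [binVec_eq_add_iff, add_comm]) rfl rfl, Finset.sum_ite_eq', if_pos (Finset.mem_univ _),
    dotProduct_add, dotProduct_add, add_dotProduct, sgn_add, sgn_add, sgn_add,
    dotProduct_comm p.1 u]
  linear_combination (-(r * sgn (u ⬝ᵥ v) * sgn (u ⬝ᵥ p.1) * sgn (p.2 ⬝ᵥ v))) *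
    sgn_mul_self (p.1 ⬝ᵥ p.2)

/-- If all generators of a group of symplectic matrices lift to unitary matrices, all its elements
do. -/
theorem exists_induces_of_mem_closure {S : Set (BlockMatrix m)}
    (hS : ∀ F ∈ S, ∃ g : UnitaryN m, InducesSymplectic g F) {F : SpBinary m}
    (hF : F ∈ Subgroup.closure {F : SpBinary m | (F : BlockMatrix m) ∈ S}) :
    ∃ g : UnitaryN m, InducesSymplectic g (F : BlockMatrix m) := by
  induction hF using Subgroup.closure_induction with
  | mem F hF => exact hS _ hF
  | one => exact ⟨pauliU 0, inducesSymplectic_pauliU 0⟩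
  | mul F F' _ _ h h' =>
    obtain ⟨g, hg⟩ := h
    obtain ⟨g', hg'⟩ := h'
    exact ⟨g' * g, hg'.mul hg⟩
  | inv F _ h =>
    obtain ⟨g, hg⟩ := h
    refine ⟨g⁻¹, inducesSymplectic_iff.mpr fun p => PauliMaps.inv ?_⟩
    have := inducesSymplectic_iff.mp hg (rowAct ((F⁻¹ : SpBinary m) : BlockMatrix m) p)
    rwa [rowAct_rowAct_inv] at this

end Lift

/-! ## The Kerdock groups -/

section Kerdock

variable {m : ℕ} {K : Type*} [Field K] [Algebra (ZMod 2) K]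
  (b : Module.Basis (Fin m) (ZMod 2) K)

theorem exists_induces_kerdockGens {F : BlockMatrix m} (hF : F ∈ kerdockGens b) :
    ∃ g : UnitaryN m, InducesSymplectic g F := by
  rcases hF with ⟨x, rfl⟩ | ⟨x, hx, rfl⟩ | rfl
  · refine exists_induces_sympT ?_
    rw [pow_two, mulMat_mul]
    exact mulMat_mul_traceMat_isSymm b _
  · exact exists_induces_sympL (Matrix.isUnit_nonsing_inv_det _ (isUnit_det_mulMat b hx))
  · obtain ⟨g, hg⟩ := exists_induces_sympOmega (m := m)
    obtain ⟨h, hh⟩ := exists_induces_sympL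
      (Matrix.isUnit_nonsing_inv_det _ (isUnit_det_traceMat b))
    exact ⟨h * g, hh.mul hg⟩

theorem exists_induces_kerdockStarGens {F : BlockMatrix m} (hF : F ∈ kerdockStarGens b) :
    ∃ g : UnitaryN m, InducesSymplectic g F := by
  rcases hF with h | ⟨x, i, hx, rfl⟩ | h
  · exact exists_induces_kerdockGens b (Or.inl h)
  · refine exists_induces_sympL ?_
    rw [Matrix.det_mul, Matrix.det_pow]
    exact ((Matrix.isUnit_nonsing_inv_det _ (isUnit_det_frobMat b)).pow _).mul
      (Matrix.isUnit_nonsing_inv_det _ (isUnit_det_mulMat b hx))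
  · exact exists_induces_kerdockGens b (Or.inr (Or.inr h))

theorem vecMul_mulMat (a : BinVec m) (z : K) :
    a ᵥ* mulMat b z = b.equivFun (b.equivFun.symm a * z) := by
  ext j
  rw [Module.Basis.equivFun_symm_apply, Finset.sum_mul, map_sum]
  simp [Matrix.vecMul, dotProduct, mulMat, Finset.sum_apply]

/-- In field terms the equation is `a x² = d`, and every element of a finite field of characteristic
two is a square. -/
theorem exists_vecMul_mulMat_sq {a : BinVec m} (ha : a ≠ 0) (d : BinVec m) :
    ∃ x : K, a ᵥ* mulMat b x ^ 2 = d := by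
  have : FiniteDimensional (ZMod 2) K := Module.Basis.finiteDimensional_of_finite b
  have : Finite K := Module.finite_of_finite (ZMod 2)
  have : CharP K 2 := charP_of_injective_algebraMap (algebraMap (ZMod 2) K).injective 2
  have ha' : b.equivFun.symm a ≠ 0 := fun h => ha (b.equivFun.symm.map_eq_zero_iff.mp h)
  obtain ⟨x, hx⟩ := FiniteField.isSquare_of_char_two (ringChar.eq K 2)
    ((b.equivFun.symm a)⁻¹ * b.equivFun.symm d)
  refine ⟨x, ?_⟩
  rw [pow_two, mulMat_mul, ← hx, vecMul_mulMat, mul_inv_cancel_left₀ ha',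
    LinearEquiv.apply_symm_apply]

/-- A function invariant under the transvection generators and the swap generator of the Kerdock
groups is constant on the nonzero row vectors. -/
theorem eq_of_kerdock_invariant {V : Type*} {f : PauliIndex m → V}
    (hT : ∀ x p, f (rowAct (sympT (mulMat b x ^ 2 * traceMat b)) p) = f p)
    (hS : ∀ p, f (rowAct (sympOmega m * sympL (traceMat b)⁻¹) p) = f p) {p q : PauliIndex m}
    (hp : p ≠ 0) (hq : q ≠ 0) : f p = f q := by
  have hW := isUnit_det_traceMat b
  have hW' : ∀ a : BinVec m, a ᵥ* (traceMat b)⁻¹ ᵥ* traceMat b = a := fun a => by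
    rw [Matrix.vecMul_vecMul, Matrix.nonsing_inv_mul _ hW, Matrix.vecMul_one]
  have hW'' : ∀ a : BinVec m, a ᵥ* traceMat b ᵥ* (traceMat b)⁻¹ = a := fun a => by
    rw [Matrix.vecMul_vecMul, Matrix.mul_nonsing_inv _ hW, Matrix.vecMul_one]
  have h1 : ∀ a c d : BinVec m, a ≠ 0 → f (a, c) = f (a, d) := by
    intro a c d ha
    -- With this `x` the second half becomes `a A_x² W + c = (d + c) + c = d`.
    obtain ⟨x, hx⟩ := exists_vecMul_mulMat_sq b ha ((d + c) ᵥ* (traceMat b)⁻¹)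
    rw [← hT x (a, c), rowAct_sympT, ← Matrix.vecMul_vecMul, hx, hW', add_assoc,
      binVec_add_self, add_zero]
  have h2 : ∀ p : PauliIndex m, ∃ d, f p = f (p.2 ᵥ* (traceMat b)⁻¹, d) := by
    intro p
    refine ⟨(rowAct (sympOmega m * sympL (traceMat b)⁻¹) p).2, ?_⟩
    rw [← hS p, rowAct_mul, rowAct_sympOmega, rowAct_sympL]
  have h3 : ∀ a a' c c' : BinVec m, a ≠ 0 → a' ≠ 0 → f (a, c) = f (a', c') := by
    intro a a' c c' ha ha'
    -- The second half is chosen so that the swap generator turns it into the first half `a'`.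
    obtain ⟨d, hd⟩ := h2 (a, a' ᵥ* traceMat b)
    rw [h1 a c _ ha, hd, hW'', h1 a' d c' ha']
  have h4 : ∀ p : PauliIndex m, p ≠ 0 → ∃ a c, a ≠ 0 ∧ f p = f (a, c) := by
    intro p hp
    by_cases h : p.1 = 0
    · obtain ⟨d, hd⟩ := h2 p
      refine ⟨_, d, fun h' => hp (Prod.ext h ?_), hd⟩
      rw [← hW' p.2, h', Matrix.zero_vecMul]
      rfl
    · exact ⟨p.1, p.2, h, rfl⟩
  obtain ⟨a, c, ha, e⟩ := h4 p hp
  obtain ⟨a', c', ha', e'⟩ := h4 q hq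
  rw [e, e', h3 a a' c c' ha ha']

end Kerdock

/-! ## Finiteness up to global phases -/

section Finiteness

variable {m : ℕ}

/-- The matrix `h†g` commutes with all Paulis, hence with all matrix units, so it is a scalar, of
modulus one by unitarity. -/
theorem phase_equiv_of_conj_eq {g h : UnitaryN m}
    (H : ∀ a b : BinVec m, (g : Matrix (BinVec m) (BinVec m) ℂ) * pauliD a b * (g : Matrix _ _ ℂ)ᴴ =
      (h : Matrix (BinVec m) (BinVec m) ℂ) * pauliD a b * (h : Matrix _ _ ℂ)ᴴ) :
    (phaseSetoid (BinVec m)).r g h := by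
  let M : Matrix (BinVec m) (BinVec m) ℂ := (h : Matrix _ _ ℂ)ᴴ * (g : Matrix _ _ ℂ)
  have hD : ∀ a b : BinVec m, M * pauliD a b = pauliD a b * M := by
    intro a b
    calc M * pauliD a b = (h : Matrix (BinVec m) (BinVec m) ℂ)ᴴ * ((g : Matrix _ _ ℂ) *
          pauliD a b * (g : Matrix _ _ ℂ)ᴴ) * (g : Matrix _ _ ℂ) := by
          simp only [M, Matrix.mul_assoc, conjTranspose_mul_unitary, Matrix.mul_one]
      _ = ((h : Matrix (BinVec m) (BinVec m) ℂ)ᴴ * (h : Matrix _ _ ℂ)) * pauliD a b * M := by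
          rw [H]
          simp only [M, Matrix.mul_assoc]
      _ = pauliD a b * M := by rw [conjTranspose_mul_unitary, Matrix.one_mul]
  have hs : ∀ u v : BinVec m, Commute (Matrix.single u v (1 : ℂ)) M := by
    intro u v
    rw [single_eq_sum_pauliD]
    refine Commute.sum_left _ _ _ fun b _ => ?_
    exact Commute.smul_left (hD _ _).symm _
  obtain ⟨c, hc⟩ := Matrix.mem_range_scalar_of_commute_single fun u v _ => hs u v
  have hM : M = c • 1 := by
    rw [← hc, Matrix.scalar_apply, Matrix.smul_one_eq_diagonal]
  have hg : (g : Matrix (BinVec m) (BinVec m) ℂ) = c • (h : Matrix _ _ ℂ) := by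
    calc (g : Matrix (BinVec m) (BinVec m) ℂ) = (h : Matrix _ _ ℂ) * M := by
          simp only [M]
          rw [← Matrix.mul_assoc, unitary_mul_conjTranspose, Matrix.one_mul]
      _ = _ := by rw [hM, Matrix.mul_smul, Matrix.mul_one]
  refine ⟨c, ?_, hg⟩
  have h1 := unitary_mul_conjTranspose g
  rw [hg, Matrix.conjTranspose_smul, Matrix.smul_mul, Matrix.mul_smul, unitary_mul_conjTranspose,
    smul_smul] at h1
  have h2 := congrFun (congrFun h1 0) 0
  simp only [Matrix.smul_apply, Matrix.one_apply_eq, smul_eq_mul, mul_one] at h2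
  have h3 := congrArg norm h2
  rw [norm_mul, norm_star, norm_one] at h3
  nlinarith [norm_nonneg c]

/-- A phase class is determined by the map `(a, b) ↦ g D(a,b) g†` between finite sets. -/
theorem finite_phaseClasses_cliffordGroup : (phaseClasses (cliffordGroup m)).Finite := by
  classical
  let f : UnitaryN m → BinVec m → BinVec m → Matrix (BinVec m) (BinVec m) ℂ := fun g a b =>
    (g : Matrix (BinVec m) (BinVec m) ℂ) * pauliD a b * (g : Matrix _ _ ℂ)ᴴ
  have hHW : (heisenbergWeyl m).Finite := by
    refine (Set.finite_range fun x : Fin 4 × BinVec m × BinVec m =>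
      Complex.I ^ (x.1 : ℕ) • pauliD x.2.1 x.2.2).subset ?_
    rintro M ⟨κ, a, b, rfl⟩
    exact ⟨(κ, a, b), rfl⟩
  have hf : (f '' cliffordGroup m).Finite := by
    refine (Set.Finite.pi' fun _ : BinVec m => Set.Finite.pi' fun _ : BinVec m => hHW).subset ?_
    rintro _ ⟨g, hg, rfl⟩ a b
    exact hg a b
  refine (hf.image fun y => Quotient.mk (phaseSetoid (BinVec m))
    (Function.invFunOn f (cliffordGroup m) y)).subset ?_
  rintro _ ⟨g, hg, rfl⟩
  refine ⟨f g, ⟨g, hg, rfl⟩, Quotient.sound (phase_equiv_of_conj_eq fun a b => ?_)⟩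
  have h := Function.invFunOn_eq (f := f) (s := cliffordGroup m) ⟨g, hg, rfl⟩
  exact congrFun (congrFun h a) b

theorem finite_phaseClasses_cliffordPreimage (G : Subgroup (SpBinary m)) :
    (phaseClasses (cliffordPreimage G)).Finite :=
  finite_phaseClasses_cliffordGroup.subset (Set.image_mono fun _ hg => hg.1)

theorem cliffordPreimage_mul {G : Subgroup (SpBinary m)} {g h : UnitaryN m}
    (hg : g ∈ cliffordPreimage G) (hh : h ∈ cliffordPreimage G) : g * h ∈ cliffordPreimage G := by
  obtain ⟨hg, F, hF, hgF⟩ := hg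
  obtain ⟨hh, F', hF', hhF⟩ := hh
  exact ⟨cliffordGroup_mul hg hh, F' * F, mul_mem hF' hF, hgF.mul hhF⟩

theorem pauliU_mem_cliffordPreimage (G : Subgroup (SpBinary m)) (p : PauliIndex m) :
    pauliU p ∈ cliffordPreimage G :=
  ⟨pauliU_mem_cliffordGroup p, 1, one_mem G, inducesSymplectic_pauliU p⟩

end Finiteness

/-! ## Designs -/

section Designs

variable {m : ℕ} {V : Type*} [AddCommGroup V] [Module ℂ V]

theorem eq_zero_of_eq_neg_self {v : V} (h : v = -v) : v = 0 := by
  have h1 : (2 : ℂ) • v = 0 := by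
    rw [two_smul]
    nth_rewrite 1 [h]
    exact neg_add_cancel v
  exact (smul_eq_zero.mp h1).resolve_left two_ne_zero

theorem kron_two_smul {n : Type*} (a b : ℂ) (A B : Matrix n n ℂ) :
    kron ![a • A, b • B] = (a * b) • kron ![A, B] := by
  ext u v
  simp only [kron, Matrix.of_apply, Fin.prod_univ_two, Matrix.cons_val_zero, Matrix.cons_val_one,
    Matrix.smul_apply, smul_eq_mul]
  ring

theorem kron_three_smul {n : Type*} (a b c : ℂ) (A B C : Matrix n n ℂ) :
    kron ![a • A, b • B, c • C] = (a * b * c) • kron ![A, B, C] := by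
  ext u v
  simp only [kron, Matrix.of_apply, Fin.prod_univ_three, Matrix.cons_val_zero,
    Matrix.cons_val_one, Matrix.cons_val, Matrix.smul_apply, smul_eq_mul]
  ring

theorem tensorConj_kron_two {n : Type*} [Fintype n] (U A B : Matrix n n ℂ) :
    tensorConj 2 U (kron ![A, B]) = kron ![U * A * Uᴴ, U * B * Uᴴ] := by
  rw [tensorConj_kron]
  congr 1
  ext t : 1
  fin_cases t <;> rfl

theorem tensorConj_kron_three {n : Type*} [Fintype n] (U A B C : Matrix n n ℂ) :
    tensorConj 3 U (kron ![A, B, C]) = kron ![U * A * Uᴴ, U * B * Uᴴ, U * C * Uᴴ] := by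
  rw [tensorConj_kron]
  congr 1
  ext t : 1
  fin_cases t <;> rfl

theorem PauliMaps.tensorConj_two {g : UnitaryN m} {p q : PauliIndex m} (h : PauliMaps g p q) :
    tensorConj 2 (g : Matrix (BinVec m) (BinVec m) ℂ) (kron ![pauli p, pauli p]) =
      kron ![pauli q, pauli q] := by
  obtain ⟨s, hs, h⟩ := h
  rw [tensorConj_kron_two, h, kron_two_smul, hs, one_smul]

/-- Some Pauli anticommutes with exactly one of the two factors; conjugating by it negates the
tensor. -/
theorem map_kron_two_eq_zero
    (L : Matrix (Fin 2 → BinVec m) (Fin 2 → BinVec m) ℂ →ₗ[ℂ] V)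
    (hL : ∀ (z : PauliIndex m) X,
      L (tensorConj 2 (pauliU z : Matrix (BinVec m) (BinVec m) ℂ) X) = L X)
    {p q : PauliIndex m} (hpq : p ≠ q) : L (kron ![pauli p, pauli q]) = 0 := by
  obtain ⟨z, hz⟩ := exists_sympForm_eq_one fun h => hpq (pauliIndex_add_eq_zero.mp h)
  refine eq_zero_of_eq_neg_self ?_
  conv_lhs => rw [← hL z]
  rw [pauliU, tensorConj_kron_two, pauli_conj, pauli_conj, kron_two_smul, ← sgn_add,
    ← sympForm_add_right, hz, sgn_one, neg_one_smul, map_neg]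

theorem map_kron_three_eq_zero
    (L : Matrix (Fin 3 → BinVec m) (Fin 3 → BinVec m) ℂ →ₗ[ℂ] V)
    (hL : ∀ (z : PauliIndex m) X,
      L (tensorConj 3 (pauliU z : Matrix (BinVec m) (BinVec m) ℂ) X) = L X)
    {p q r : PauliIndex m} (h : p + q ≠ r) : L (kron ![pauli p, pauli q, pauli r]) = 0 := by
  obtain ⟨z, hz⟩ := exists_sympForm_eq_one fun h' => h (pauliIndex_add_eq_zero.mp h')
  refine eq_zero_of_eq_neg_self ?_
  conv_lhs => rw [← hL z]
  rw [pauliU, tensorConj_kron_three, pauli_conj, pauli_conj, pauli_conj, kron_three_smul,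
    ← sgn_add, ← sgn_add, ← sympForm_add_right, ← sympForm_add_right, hz, sgn_one, neg_one_smul,
    map_neg]

/-- A linear map on operators on three tensor factors that is invariant under the Clifford group
and kills the operators fixed by all unitaries vanishes. -/
theorem linearMap_three_eq_zero_of_clifford
    (L : Matrix (Fin 3 → BinVec m) (Fin 3 → BinVec m) ℂ →ₗ[ℂ] V)
    (hL : ∀ g ∈ cliffordGroup m, ∀ X,
      L (tensorConj 3 (g : Matrix (BinVec m) (BinVec m) ℂ) X) = L X)
    (hfix : ∀ X ∈ unitaryFixed (BinVec m) 3, L X = 0) : L = 0 := by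
  have hone : ∀ g : UnitaryN m, (g : Matrix (BinVec m) (BinVec m) ℂ) * 1 * (g : Matrix _ _ ℂ)ᴴ =
      (1 : ℂ) • 1 := fun g => by
    rw [Matrix.mul_one, unitary_mul_conjTranspose, one_smul]
  refine linearMap_three_eq_zero L
    (fun p q r h => map_kron_three_eq_zero L (fun z => hL _ (pauliU_mem_cliffordGroup z)) h)
    (fun p q hp hq => ⟨?_, ?_, ?_⟩) (fun p q p' q' hp hq hpq hp' hq' hpq' h => ?_) hfix
  · refine eq_of_transvec_invariant (f := fun p => L (kron ![pauli p, pauli p, 1]))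
      (fun w p => ?_) hp hq
    obtain ⟨g, hg, hw⟩ := exists_clifford_transvec w
    obtain ⟨s, hs, h⟩ := hw p
    rw [← hL g hg (kron ![pauli p, pauli p, 1]), tensorConj_kron_three, h, hone, kron_three_smul,
      hs, mul_one, one_smul]
  · refine eq_of_transvec_invariant (f := fun p => L (kron ![pauli p, 1, pauli p]))
      (fun w p => ?_) hp hq
    obtain ⟨g, hg, hw⟩ := exists_clifford_transvec w
    obtain ⟨s, hs, h⟩ := hw p
    rw [← hL g hg (kron ![pauli p, 1, pauli p]), tensorConj_kron_three, h, hone, kron_three_smul,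
      mul_one, hs, one_smul]
  · refine eq_of_transvec_invariant (f := fun p => L (kron ![1, pauli p, pauli p]))
      (fun w p => ?_) hp hq
    obtain ⟨g, hg, hw⟩ := exists_clifford_transvec w
    obtain ⟨s, hs, h⟩ := hw p
    rw [← hL g hg (kron ![1, pauli p, pauli p]), tensorConj_kron_three, h, hone, kron_three_smul,
      one_mul, hs, one_smul]
  · refine eq_of_transvec_invariant₂
      (f := fun p q => L (kron ![pauli p, pauli q, pauli p * pauli q]))
      (fun w p q => ?_) hp hq hpq hp' hq' hpq' h
    obtain ⟨g, hg, hw⟩ := exists_clifford_transvec w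
    obtain ⟨s, hs, hp⟩ := hw p
    obtain ⟨t, ht, hq⟩ := hw q
    -- The signs `s` and `t` of the first two slots recur in the third as `s * t`, so they cancel.
    rw [← hL g hg (kron ![pauli p, pauli q, pauli p * pauli q]), tensorConj_kron_three,
      ← conj_mul_conj, hp, hq, Matrix.smul_mul, Matrix.mul_smul, smul_smul, kron_three_smul,
      mul_mul_mul_comm, hs, ht, mul_one, one_smul]

theorem isUnitaryDesign_three_of_isUniformOn_cliffordGroup {ι : Type*} [Fintype ι]
    {E : UnitaryEnsemble ι (BinVec m)} (hE : E.IsUniformOn (cliffordGroup m)) :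
    E.IsUnitaryDesign 3 :=
  E.isUnitaryDesign_of_defect <| linearMap_three_eq_zero_of_clifford _
    (fun _ hg X => hE.defect_tensorConj (fun _ hg _ hh => cliffordGroup_mul hg hh) 3 hg X)
    fun _ hX => E.defect_of_mem_unitaryFixed hX

/-- A group of symplectic matrices is Pauli mixing if its elements lift to unitary matrices and
every invariant function is constant on the nonzero row vectors, i.e. the group is transitive on
them. -/
structure IsPauliMixing (G : Subgroup (SpBinary m)) : Prop where
  exists_induces : ∀ F ∈ G, ∃ g : UnitaryN m, InducesSymplectic g (F : BlockMatrix m)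
  eq_of_invariant : ∀ f : PauliIndex m → Matrix (Fin 2 → BinVec m) (Fin 2 → BinVec m) ℂ,
    (∀ F ∈ G, ∀ p, f (rowAct (F : BlockMatrix m) p) = f p) → ∀ p q, p ≠ 0 → q ≠ 0 → f p = f q

/-- The generators `T` and `Ω L_{W⁻¹}`, shared by both groups, already give transitivity; the others
only have to lift. -/
theorem isPauliMixing_of_kerdockGens_subset {K : Type*} [Field K] [Algebra (ZMod 2) K]
    (b : Module.Basis (Fin m) (ZMod 2) K) {S : Set (BlockMatrix m)}
    (hS : ∀ F ∈ S, ∃ g : UnitaryN m, InducesSymplectic g F)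
    (hT : ∀ x : K, sympT (mulMat b x ^ 2 * traceMat b) ∈ S)
    (hO : sympOmega m * sympL (traceMat b)⁻¹ ∈ S) :
    IsPauliMixing (Subgroup.closure {F : SpBinary m | (F : BlockMatrix m) ∈ S}) where
  exists_induces _ hF := exists_induces_of_mem_closure hS hF
  eq_of_invariant _ hf _ _ hp hq :=
    eq_of_kerdock_invariant b
      (fun x => hf ⟨_, kerdockGens_subset b (Or.inl ⟨x, rfl⟩)⟩ (Subgroup.subset_closure (hT x)))
      (hf ⟨_, kerdockGens_subset b (Or.inr (Or.inr rfl))⟩ (Subgroup.subset_closure hO)) hp hq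

theorem isPauliMixing_kerdockGroup {K : Type*} [Field K] [Algebra (ZMod 2) K]
    (b : Module.Basis (Fin m) (ZMod 2) K) : IsPauliMixing (kerdockGroup b) :=
  isPauliMixing_of_kerdockGens_subset b (fun _ => exists_induces_kerdockGens b)
    (fun x => Or.inl ⟨x, rfl⟩) (Or.inr (Or.inr rfl))

theorem isPauliMixing_kerdockStarGroup {K : Type*} [Field K] [Algebra (ZMod 2) K]
    (b : Module.Basis (Fin m) (ZMod 2) K) : IsPauliMixing (kerdockStarGroup b) :=
  isPauliMixing_of_kerdockGens_subset b (fun _ => exists_induces_kerdockStarGens b)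
    (fun x => Or.inl ⟨x, rfl⟩) (Or.inr (Or.inr rfl))

theorem IsPauliMixing.linearMap_eq_zero {G : Subgroup (SpBinary m)} (hG : IsPauliMixing G)
    (L : Matrix (Fin 2 → BinVec m) (Fin 2 → BinVec m) ℂ →ₗ[ℂ]
      Matrix (Fin 2 → BinVec m) (Fin 2 → BinVec m) ℂ)
    (hL : ∀ g ∈ cliffordPreimage G, ∀ X,
      L (tensorConj 2 (g : Matrix (BinVec m) (BinVec m) ℂ) X) = L X)
    (hfix : ∀ X ∈ unitaryFixed (BinVec m) 2, L X = 0) : L = 0 := by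
  refine linearMap_two_eq_zero L
    (fun p q => map_kron_two_eq_zero L fun z => hL _ (pauliU_mem_cliffordPreimage G z))
    (hG.eq_of_invariant (fun p => L (kron ![pauli p, pauli p])) fun F hF p => ?_) hfix
  obtain ⟨g, hg⟩ := hG.exists_induces F hF
  rw [← hL g ⟨hg.mem_cliffordGroup, F, hF, hg⟩ (kron ![pauli p, pauli p]),
    (inducesSymplectic_iff.mp hg p).tensorConj_two]

theorem IsPauliMixing.isUnitaryDesign {G : Subgroup (SpBinary m)} (hG : IsPauliMixing G)
    {ι : Type*} [Fintype ι] {E : UnitaryEnsemble ι (BinVec m)}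
    (hE : E.IsUniformOn (cliffordPreimage G)) : E.IsUnitaryDesign 2 :=
  E.isUnitaryDesign_of_defect <| hG.linearMap_eq_zero _
    (fun _ hg X => hE.defect_tensorConj (fun _ hg _ hh => cliffordPreimage_mul hg hh) 2 hg X)
    fun _ hX => E.defect_of_mem_unitaryFixed hX

/-- The average over the conjugations by Pauli matrices. -/
def pauliAvg (m k : ℕ) : Matrix (Fin k → BinVec m) (Fin k → BinVec m) ℂ →ₗ[ℂ]
    Matrix (Fin k → BinVec m) (Fin k → BinVec m) ℂ :=
  (((2 : ℂ) ^ m) ^ 2)⁻¹ • ∑ z : PauliIndex m, tensorConjLin k (pauliD z.1 z.2)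

theorem pauliAvg_apply {k : ℕ} (X : Matrix (Fin k → BinVec m) (Fin k → BinVec m) ℂ) :
    pauliAvg m k X =
      (((2 : ℂ) ^ m) ^ 2)⁻¹ • ∑ z : PauliIndex m, tensorConj k (pauliD z.1 z.2) X := by
  simp [pauliAvg, tensorConjLin]

theorem UnitaryEnsemble.twirl_thenPauli {ι : Type*} [Fintype ι]
    (E : UnitaryEnsemble ι (BinVec m)) (k : ℕ)
    (X : Matrix (Fin k → BinVec m) (Fin k → BinVec m) ℂ) :
    E.thenPauli.twirl k X = pauliAvg m k (E.twirl k X) := by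
  rw [UnitaryEnsemble.twirl, UnitaryEnsemble.twirl, map_sum, Fintype.sum_prod_type]
  refine Finset.sum_congr rfl fun i _ => ?_
  rw [map_smul, pauliAvg_apply, smul_smul, Finset.smul_sum]
  refine Finset.sum_congr rfl fun z _ => ?_
  rw [tensorConj_comp]
  simp only [UnitaryEnsemble.thenPauli, pauliDU, Matrix.UnitaryGroup.mul_val]
  congr 1
  push_cast
  rw [div_eq_mul_inv]

/-- The Pauli multiplies on the left, so right invariance of the twirl survives. -/
theorem IsPauliMixing.isUnitaryDesign_thenPauli {G : Subgroup (SpBinary m)}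
    (hG : IsPauliMixing G) {ι : Type*} [Fintype ι] {E : UnitaryEnsemble ι (BinVec m)}
    (hE : E.IsUniformOn (cliffordPreimage G)) : E.thenPauli.IsUnitaryDesign 2 :=
  E.thenPauli.isUnitaryDesign_of_defect <| hG.linearMap_eq_zero _
    (fun _ hg X => by
      rw [UnitaryEnsemble.defect_apply, UnitaryEnsemble.defect_apply, E.twirl_thenPauli,
        hE.twirl_tensorConj (fun _ hg _ hh => cliffordPreimage_mul hg hh) 2 hg,
        haarTwirl_tensorConj, E.twirl_thenPauli])
    fun _ hX => E.thenPauli.defect_of_mem_unitaryFixed hX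

/-! ### Uniform symplectic sampling with arbitrary lifts -/

theorem sum_sgn_sympForm {x : PauliIndex m} (hx : x ≠ 0) :
    ∑ z : PauliIndex m, sgn (sympForm z x) = 0 := by
  obtain ⟨w, hw⟩ := exists_sympForm_eq_one hx
  refine eq_zero_of_eq_neg_self ?_
  conv_lhs => rw [← Equiv.sum_comp (Equiv.addRight w)]
  rw [← Finset.sum_neg_distrib]
  refine Finset.sum_congr rfl fun z _ => ?_
  rw [Equiv.coe_addRight, sympForm_add_left, sgn_add, hw, sgn_one, mul_neg_one]

/-- Averaging over Paulis is a character sum in `p + q`, hence a projection onto the equal pairs. -/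
theorem pauliAvg_kron_two (p q : PauliIndex m) :
    pauliAvg m 2 (kron ![pauli p, pauli q]) = if p = q then kron ![pauli p, pauli p] else 0 := by
  have h : ∀ z : PauliIndex m, tensorConj 2 (pauliD z.1 z.2) (kron ![pauli p, pauli q]) =
      sgn (sympForm z (p + q)) • kron ![pauli p, pauli q] := by
    intro z
    rw [tensorConj_kron_two, pauliD_conj, pauliD_conj, kron_two_smul, ← sgn_add,
      ← sympForm_add_right]
  rw [pauliAvg_apply, Finset.sum_congr rfl fun z _ => h z, ← Finset.sum_smul]
  split_ifs with hpq
  · subst hpq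
    have h2 : ((2 : ℂ) ^ m) ^ 2 ≠ 0 := pow_ne_zero _ (pow_ne_zero _ two_ne_zero)
    simp only [pauliIndex_add_self, sympForm_zero_right, sgn_zero, smul_smul, Finset.sum_const,
      Finset.card_univ, Fintype.card_prod, Fintype.card_pi, ZMod.card, Finset.prod_const,
      Fintype.card_fin, nsmul_eq_mul, mul_one]
    rw [← pow_two]
    push_cast
    rw [inv_mul_cancel₀ h2, one_smul]
  · rw [sum_sgn_sympForm fun h' => hpq (pauliIndex_add_eq_zero.mp h'), zero_smul, smul_zero]

theorem UnitaryEnsemble.LiftsUniform.twirl_thenPauli_of_ne {G : Subgroup (SpBinary m)}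
    {ι : Type*} [Fintype ι] {E : UnitaryEnsemble ι (BinVec m)} (hE : E.LiftsUniform G)
    {p q : PauliIndex m} (hpq : p ≠ q) : E.thenPauli.twirl 2 (kron ![pauli p, pauli q]) = 0 := by
  rw [E.twirl_thenPauli, UnitaryEnsemble.twirl, map_sum]
  refine Finset.sum_eq_zero fun i _ => ?_
  by_cases hi : E.prob i = 0
  · rw [hi, Complex.ofReal_zero, zero_smul, map_zero]
  obtain ⟨-, F, -, hF⟩ := hE.1 i hi
  rw [inducesSymplectic_iff] at hF
  obtain ⟨s, -, hs⟩ := hF p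
  obtain ⟨t, -, ht⟩ := hF q
  have hne : rowAct (F : BlockMatrix m) p ≠ rowAct (F : BlockMatrix m) q := fun h => hpq <| by
    rw [← rowAct_inv_rowAct F p, h, rowAct_inv_rowAct]
  rw [map_smul, tensorConj_kron_two, hs, ht, kron_two_smul, map_smul, pauliAvg_kron_two,
    if_neg hne, smul_zero, smul_zero]

/-- On equal pairs signs cancel and the Pauli average does nothing, so only the induced symplectic
matrix matters, not the lift. -/
theorem UnitaryEnsemble.LiftsUniform.twirl_thenPauli {G : Subgroup (SpBinary m)} [Fintype G]
    {ι : Type*} [Fintype ι] {E : UnitaryEnsemble ι (BinVec m)} (hE : E.LiftsUniform G)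
    (p : PauliIndex m) : E.thenPauli.twirl 2 (kron ![pauli p, pauli p]) =
      ∑ F : G, ((1 / (Nat.card G : ℝ) : ℝ) : ℂ) •
        kron ![pauli (rowAct (F : BlockMatrix m) p), pauli (rowAct (F : BlockMatrix m) p)] := by
  classical
  have h1 : ∀ i, pauliAvg m 2 ((E.prob i : ℂ) • tensorConj 2
      (E.unitary i : Matrix (BinVec m) (BinVec m) ℂ) (kron ![pauli p, pauli p])) =
      ∑ F : G, ((if InducesSymplectic (E.unitary i) (F : BlockMatrix m) then E.prob i else 0 : ℝ) : ℂ) •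
        kron ![pauli (rowAct (F : BlockMatrix m) p), pauli (rowAct (F : BlockMatrix m) p)] := by
    intro i
    by_cases hi : E.prob i = 0
    · simp [hi]
    obtain ⟨-, F, hFG, hF⟩ := hE.1 i hi
    -- A Clifford matrix induces exactly one symplectic matrix, so one term survives.
    rw [Finset.sum_eq_single (⟨F, hFG⟩ : G)]
    · rw [if_pos hF, (inducesSymplectic_iff.mp hF p).tensorConj_two, map_smul, pauliAvg_kron_two,
        if_pos rfl]
    · intro F' _ hne
      rw [if_neg fun hF' => hne (Subtype.ext (Subtype.ext (hF'.eq hF))), Complex.ofReal_zero,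
        zero_smul]
    · exact fun h => absurd (Finset.mem_univ _) h
  rw [E.twirl_thenPauli, UnitaryEnsemble.twirl, map_sum, Finset.sum_congr rfl fun i _ => h1 i,
    Finset.sum_comm]
  refine Finset.sum_congr rfl fun F _ => ?_
  rw [← Finset.sum_smul, ← Complex.ofReal_sum, ← hE.2 F F.2]

/-- The lifts need not be uniform within a fibre of `φ`, so invariance is checked on Pauli pairs
only: the ensemble part by reindexing the average over `G`, the Haar part by absorbing a lift of
`F`. -/
theorem IsPauliMixing.isUnitaryDesign_thenPauli_of_liftsUniform {G : Subgroup (SpBinary m)}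
    (hG : IsPauliMixing G) {ι : Type*} [Fintype ι] {E : UnitaryEnsemble ι (BinVec m)}
    (hE : E.LiftsUniform G) : E.thenPauli.IsUnitaryDesign 2 := by
  have := Fintype.ofFinite G
  refine E.thenPauli.isUnitaryDesign_of_defect <| linearMap_two_eq_zero _ (fun p q hpq => ?_)
    (hG.eq_of_invariant (fun p => E.thenPauli.defect 2 (kron ![pauli p, pauli p]))
      fun F hF p => ?_)
    fun X hX => E.thenPauli.defect_of_mem_unitaryFixed hX
  · rw [UnitaryEnsemble.defect_apply, hE.twirl_thenPauli_of_ne hpq, zero_sub, neg_eq_zero]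
    exact map_kron_two_eq_zero (haarTwirlLin (BinVec m) 2)
      (fun z X => haarTwirl_tensorConj 2 (pauliU z) X) hpq
  · obtain ⟨g, hg⟩ := hG.exists_induces F hF
    rw [UnitaryEnsemble.defect_apply, UnitaryEnsemble.defect_apply, hE.twirl_thenPauli,
      hE.twirl_thenPauli, ← (inducesSymplectic_iff.mp hg p).tensorConj_two, haarTwirl_tensorConj]
    have hmul : ∀ F' : G, rowAct (((⟨F, hF⟩ * F' : G) : SpBinary m) : BlockMatrix m) p =
        rowAct (F' : BlockMatrix m) (rowAct (F : BlockMatrix m) p) := fun F' => rowAct_mul _ _ _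
    refine congrArg (· - _) ((Finset.sum_congr rfl fun F' _ => ?_).trans
      (Equiv.sum_comp (Equiv.mulLeft (⟨F, hF⟩ : G)) fun F' : G =>
        ((1 / (Nat.card G : ℝ) : ℝ) : ℂ) • kron ![pauli (rowAct (F' : BlockMatrix m) p),
          pauli (rowAct (F' : BlockMatrix m) p)]))
    rw [Equiv.coe_mulLeft, hmul]

end Designs

end KerdockDesign

end

theorem mainTheorem2 {m : ℕ} (hm : 0 < m) {K : Type*} [Field K] [Algebra (ZMod 2) K]
    (hK : Module.finrank (ZMod 2) K = m) (α : K) (hα : IsPrimitiveRoot α (2 ^ m - 1)) :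
    -- uniform sampling from the Clifford group
    ((phaseClasses (cliffordGroup m)).Finite ∧
      ∀ (ι : Type) [Fintype ι] (E : UnitaryEnsemble ι (BinVec m)),
        E.IsUniformOn (cliffordGroup m) → E.IsUnitaryDesign 3) ∧
    -- sampling from the two Kerdock groups
    ∀ G : Subgroup (SpBinary m),
      (G = kerdockGroup (polyBasis hm hK α hα) ∨ G = kerdockStarGroup (polyBasis hm hK α hα)) →
      (phaseClasses (cliffordPreimage G)).Finite ∧
      (∀ F ∈ G, ∃ g ∈ cliffordGroup m, InducesSymplectic g (F : BlockMatrix m)) ∧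
      ∀ (ι : Type) [Fintype ι] (E : UnitaryEnsemble ι (BinVec m)),
        (E.IsUniformOn (cliffordPreimage G) →
          E.IsUnitaryDesign 2 ∧ E.thenPauli.IsUnitaryDesign 2) ∧
        (E.LiftsUniform G → E.thenPauli.IsUnitaryDesign 2) := by
  refine ⟨⟨finite_phaseClasses_cliffordGroup,
    fun ι _ E hE => isUnitaryDesign_three_of_isUniformOn_cliffordGroup hE⟩, fun G hG => ?_⟩
  have hmix : IsPauliMixing G := by
    rcases hG with rfl | rfl
    · exact isPauliMixing_kerdockGroup _
    · exact isPauliMixing_kerdockStarGroup _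
  refine ⟨finite_phaseClasses_cliffordPreimage G, fun F hF => ?_, fun ι _ E =>
    ⟨fun hE => ⟨hmix.isUnitaryDesign hE, hmix.isUnitaryDesign_thenPauli hE⟩,
      hmix.isUnitaryDesign_thenPauli_of_liftsUniform⟩⟩
  obtain ⟨g, hg⟩ := hmix.exists_induces F hF
  exact ⟨g, hg.mem_cliffordGroup, hg⟩
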